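/- Let $N\ge 1$ and $M\ge 0$ be integers, let $k_1<\dots<k_M$ be positive integers with $k_M<N$ (no condition if $M=0$), and put $\Lambda=\{0,\dots,N\}\setminus\{k_1,\dots,k_M\}$. Let $\mathcal P(\Lambda)$ be the space of polynomials $\sum_{k\in\Lambda}c_kz^k$ with complex coefficients, normed as a subspace of $L^1(\mathbb T)$ by $\|f\|_1=\frac1{2\pi}\int_{\mathbb T}|f(\zeta)|\,|d\zeta|$, where $\mathbb T=\{|\zeta|=1\}$. A point $\xi$ of the closed unit ball $\mathrm{ball}(X)$ of a complex normed space $X$ is called exposed if there is $\phi\in X^*$ with $\|\phi\|=1$ and $\{x\in\mathrm{ball}(X):\phi(x)=1\}=\{\xi\}$. Let $p(z)=\sum_{k=0}^Nc_kz^k\in\mathcal P(\Lambda)$ with $\|p\|_1=1$, and put $p^*(z)=\sum_{k=0}^N\overline{c_k}z^{N-k}$. Let $a_1,\dots,a_n$ be the distinct common zeros of $p$ and $p^*$ in the open unit disk, and let $m_j$ be the minimum of the multiplicities of $a_j$ as a zero of $p$ and of $p^*$. Let $\zeta_1,\dots,\zeta_\nu$ be the distinct zeros of $p$ on $\mathbb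 T$, of multiplicities $\lambda_1,\dots,\lambda_\nu$, and let $\mu_j=\lfloor\lambda_j/2\rfloor$. Put $\widetilde m=\sum_jm_j+\sum_j\mu_j$, $$G(z)=\prod_{j=1}^n(z-a_j)^{m_j}(1-\overline{a_j}z)^{m_j},\qquad G_0(z)=\prod_{j=1}^\nu(z-\zeta_j)^{\mu_j}(1-\overline{\zeta_j}z)^{\mu_j},\qquad \widetilde G=GG_0,$$ and let $\widetilde R=p/\widetilde G$, which is a polynomial. For $k\in\mathbb Z$ let $\widetilde C_k$ be the coefficient of $z^k$ in $\widetilde R$ (zero if $k<0$ or $k>\deg\widetilde R$), and put $\widetilde A(k)=\operatorname{Re}\widetilde C_k$, $\widetilde B(k)=\operatorname{Im}\widetilde C_k$. For $1\le j\le M$ and $0\le l\le\widetilde m$ put $$\widetilde A^{\pm}_{j,l}=\widetilde A(k_j+l-\widetilde m)\pm\widetilde A(k_j-l-\widetilde m),\qquad \widetilde B^{\pm}_{j,l}=\widetilde B(k_j+l-\widetilde m)\pm\widetilde B(k_j-l-\widetilde m).$$ Let $\widetilde{\mathcal A}^+,\widetilde{\mathcal B}^+$ be the $M\times(\widetilde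 m+1)$ matrices with entries $\widetilde A^+_{j,l},\widetilde B^+_{j,l}$ $(0\le l\le\widetilde m)$, let $\widetilde{\mathcal A}^-,\widetilde{\mathcal B}^-$ be the $M\times\widetilde m$ matrices with entries $\widetilde A^-_{j,l},\widetilde B^-_{j,l}$ $(1\le l\le\widetilde m)$, and let $$\widetilde{\mathfrak M}=\begin{pmatrix}\widetilde{\mathcal A}^+&\widetilde{\mathcal B}^-\\ \widetilde{\mathcal B}^+&-\widetilde{\mathcal A}^-\end{pmatrix},\qquad \widetilde{\mathcal N}=\ker\widetilde{\mathfrak M}\subset\mathbb R^{2\widetilde m+1}.$$ For an integer $d\ge0$, a vector $(\alpha_0,\dots,\alpha_d,\beta_1,\dots,\beta_d)\in\mathbb R^{2d+1}$ is called a plus-vector if $\alpha_0+\sum_{k=1}^d(\alpha_k\cos kt-\beta_k\sin kt)\ge0$ for all $t\in(-\pi,\pi]$, and the plus-dimension $\dim_+V$ of a subspace $V\subset\mathbb R^{2d+1}$ is the maximum number of linearly independent plus-vectors in $V$. Then $p$ is an exposed point of $\mathrm{ball}(\mathcal P(\Lambda))$ if and only if $\dim_+\widetilde{\mathcal N}=1$.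 -/

import Mathlib

open Polynomial MeasureTheory Real

noncomputable section

namespace Fewnomial

/-- A circle of length `2π`, parametrized by arc length `t`; the point with parameter `t` is
`AddCircle.toCircle t = exp (i t)`. -/
abbrev Arc : Type := AddCircle (2 * π)

instance arcPos : Fact (0 < 2 * π) := ⟨Real.two_pi_pos⟩

/-- `L¹(𝕋)` with respect to the normalized Lebesgue measure `|dζ| / 2π`. -/
abbrev L1 : Type := Lp ℂ 1 (AddCircle.haarAddCircle : Measure Arc)

/-- The restriction of a polynomial to the unit circle, as a continuous function. -/
def onCircle : ℂ[X] →ₗ[ℂ] C(Arc, ℂ) where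
  toFun p := ⟨fun t => p.eval (AddCircle.toCircle t : ℂ),
    p.continuous.comp (continuous_subtype_val.comp AddCircle.continuous_toCircle)⟩
  map_add' p q := by ext t; simp
  map_smul' c p := by ext t; simp

/-- The embedding of polynomials in `L¹(𝕋)`. -/
def toL1 : ℂ[X] →ₗ[ℂ] L1 :=
  (ContinuousMap.toLp (E := ℂ) 1 (AddCircle.haarAddCircle : Measure Arc) ℂ).toLinearMap ∘ₗ onCircle

/-- `Λ = {0, …, N} \ {k₁, …, k_M}`. -/
def freq (N : ℕ) {M : ℕ} (k : Fin M → ℕ) : Finset ℕ :=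
  Finset.range (N + 1) \ Finset.univ.image k

/-- `𝒫(Λ)`: the polynomials `∑ c_k z^k` with `k` running through `Λ`. -/
def fewnomials (Λ : Finset ℕ) : Submodule ℂ ℂ[X] where
  carrier := {p | p.support ⊆ Λ}
  zero_mem' := by simp
  add_mem' {p q} hp hq := Polynomial.support_add.trans (Finset.union_subset hp hq)
  smul_mem' c p hp := (Polynomial.support_smul c p).trans hp

/-- `𝒫(Λ)` as a normed space, namely as a subspace of `L¹(𝕋)`. -/
abbrev fewnomialsL1 (Λ : Finset ℕ) : Submodule ℂ L1 := (fewnomials Λ).map toL1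

/-- `ξ` is an exposed point of the closed unit ball of the complex normed space `X`: some
functional of norm `1` takes the value `1` on the ball at `ξ` and nowhere else. -/
def IsExposedPointOfBall {X : Type*} [NormedAddCommGroup X] [NormedSpace ℂ X] (ξ : X) : Prop :=
  ∃ φ : X →L[ℂ] ℂ, ‖φ‖ = 1 ∧ {x : X | ‖x‖ ≤ 1 ∧ φ x = 1} = {ξ}

/-- `p*(z) = ∑_{k ≤ N} conj (c_k) z^(N-k)` for `p(z) = ∑_{k ≤ N} c_k z^k`. -/
def pstar (N : ℕ) (p : ℂ[X]) : ℂ[X] := (p.map (starRingEnd ℂ)).reflect N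

/-- The distinct common zeros `a_j` of `p` and `p*` in the open unit disk (for `p ≠ 0`). -/
def diskZeros (N : ℕ) (p : ℂ[X]) : Finset ℂ :=
  open Classical in {a ∈ p.roots.toFinset | (pstar N p).IsRoot a ∧ ‖a‖ < 1}

/-- `m_j`, as a function of the point `a_j`. -/
def diskMult (N : ℕ) (p : ℂ[X]) (a : ℂ) : ℕ :=
  min (p.rootMultiplicity a) ((pstar N p).rootMultiplicity a)

/-- The distinct zeros `ζ_j` of `p` on the unit circle (for `p ≠ 0`). -/
def circleZeros (p : ℂ[X]) : Finset ℂ :=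
  open Classical in {ζ ∈ p.roots.toFinset | ‖ζ‖ = 1}

/-- `μ_j = [λ_j / 2]`, as a function of the point `ζ_j`. -/
def circleMult (p : ℂ[X]) (ζ : ℂ) : ℕ := p.rootMultiplicity ζ / 2

/-- `m̃ = ∑ m_j + ∑ μ_j`. -/
def mTilde (N : ℕ) (p : ℂ[X]) : ℕ :=
  ∑ a ∈ diskZeros N p, diskMult N p a + ∑ ζ ∈ circleZeros p, circleMult p ζ

/-- `G(z) = ∏ (z - a_j)^{m_j} (1 - conj(a_j) z)^{m_j}`. -/
def G (N : ℕ) (p : ℂ[X]) : ℂ[X] :=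
  ∏ a ∈ diskZeros N p,
    (X - C a) ^ diskMult N p a * (1 - C (starRingEnd ℂ a) * X) ^ diskMult N p a

/-- `G₀(z) = ∏ (z - ζ_j)^{μ_j} (1 - conj(ζ_j) z)^{μ_j}`. -/
def G₀ (p : ℂ[X]) : ℂ[X] :=
  ∏ ζ ∈ circleZeros p,
    (X - C ζ) ^ circleMult p ζ * (1 - C (starRingEnd ℂ ζ) * X) ^ circleMult p ζ

/-- `G̃ = G G₀`. -/
def GTilde (N : ℕ) (p : ℂ[X]) : ℂ[X] := G N p * G₀ p

/-- `R̃ = p / G̃`; for `p ≠ 0` of degree at most `N` the division has no remainder. -/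
def RTilde (N : ℕ) (p : ℂ[X]) : ℂ[X] := p / GTilde N p

/-- The Fourier coefficients `C̃_k` (`k ∈ ℤ`) of `R̃`. -/
def CTilde (N : ℕ) (p : ℂ[X]) (k : ℤ) : ℂ := if 0 ≤ k then (RTilde N p).coeff k.toNat else 0

/-- `Ã(k) = Re C̃_k`. -/
def ATilde (N : ℕ) (p : ℂ[X]) (k : ℤ) : ℝ := (CTilde N p k).re

/-- `B̃(k) = Im C̃_k`. -/
def BTilde (N : ℕ) (p : ℂ[X]) (k : ℤ) : ℝ := (CTilde N p k).im

/-- The matrix with entries `f(k_j + l - d) + f(k_j - l - d)`, `l = 0, …, d`. -/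
def plusMatrix {M : ℕ} (k : Fin M → ℕ) (d : ℕ) (f : ℤ → ℝ) : Matrix (Fin M) (Fin (d + 1)) ℝ :=
  Matrix.of fun j l => f ((k j : ℤ) + (l : ℤ) - (d : ℤ)) + f ((k j : ℤ) - (l : ℤ) - (d : ℤ))

/-- The matrix with entries `f(k_j + l - d) - f(k_j - l - d)`, `l = 1, …, d`; the column with
index `i : Fin d` is the one for `l = i + 1`. -/
def minusMatrix {M : ℕ} (k : Fin M → ℕ) (d : ℕ) (f : ℤ → ℝ) : Matrix (Fin M) (Fin d) ℝ :=
  Matrix.of fun j i =>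
    f ((k j : ℤ) + ((i : ℤ) + 1) - (d : ℤ)) - f ((k j : ℤ) - ((i : ℤ) + 1) - (d : ℤ))

/-- The block matrix with block rows `(Ã⁺, B̃⁻)` and `(B̃⁺, -Ã⁻)`, of size `2M × (2m̃ + 1)`. -/
def MTilde (N : ℕ) {M : ℕ} (k : Fin M → ℕ) (p : ℂ[X]) :
    Matrix (Fin M ⊕ Fin M) (Fin (mTilde N p + 1) ⊕ Fin (mTilde N p)) ℝ :=
  Matrix.fromBlocks
    (plusMatrix k (mTilde N p) (ATilde N p)) (minusMatrix k (mTilde N p) (BTilde N p))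
    (plusMatrix k (mTilde N p) (BTilde N p)) (-minusMatrix k (mTilde N p) (ATilde N p))

/-- `Ñ = ker M̃`, a subspace of `ℝ^(2m̃ + 1)`. -/
def NTilde (N : ℕ) {M : ℕ} (k : Fin M → ℕ) (p : ℂ[X]) :
    Submodule ℝ (Fin (mTilde N p + 1) ⊕ Fin (mTilde N p) → ℝ) :=
  LinearMap.ker (MTilde N k p).mulVecLin

/-- Plus-vectors. The vector `(α₀, α₁, …, α_d, β₁, …, β_d)` is `v`, with `α_l = v (inl l)` and
`β_(i+1) = v (inr i)`. -/
def IsPlusVector {d : ℕ} (v : Fin (d + 1) ⊕ Fin d → ℝ) : Prop :=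
  ∀ t ∈ Set.Ioc (-π) π,
    0 ≤ v (Sum.inl 0) + ∑ i : Fin d,
      (v (Sum.inl i.succ) * cos (((i : ℝ) + 1) * t) - v (Sum.inr i) * sin (((i : ℝ) + 1) * t))

/-- The numbers `n` such that `V` contains `n` linearly independent plus-vectors. -/
def plusCounts {d : ℕ} (V : Submodule ℝ (Fin (d + 1) ⊕ Fin d → ℝ)) : Set ℕ :=
  {n | ∃ w : Fin n → (Fin (d + 1) ⊕ Fin d → ℝ),
    LinearIndependent ℝ w ∧ ∀ i, w i ∈ V ∧ IsPlusVector (w i)}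

/-- The plus-dimension: the maximum number of linearly independent plus-vectors in `V`. -/
def plusDim {d : ℕ} (V : Submodule ℝ (Fin (d + 1) ⊕ Fin d → ℝ)) : ℕ := sSup (plusCounts V)

/-- The supremum in the definition of the plus-dimension is a maximum. -/
theorem isGreatest_plusDim {d : ℕ} (V : Submodule ℝ (Fin (d + 1) ⊕ Fin d → ℝ)) :
    IsGreatest (plusCounts V) (plusDim V) := by
  have hb : BddAbove (plusCounts V) := by
    refine ⟨Module.finrank ℝ (Fin (d + 1) ⊕ Fin d → ℝ), ?_⟩
    rintro n ⟨w, hw, -⟩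
    simpa using hw.fintype_card_le_finrank
  exact ⟨Nat.sSup_mem ⟨0, Fin.elim0, linearIndependent_empty_type, fun i => i.elim0⟩ hb,
    fun n hn => le_csSup hb hn⟩

end Fewnomial

end

namespace Fewnomial

open scoped ComplexOrder

/-! ### The conjugate reciprocal polynomial -/

/-! The exposing property reduces to a positivity problem, and positivity to divisibility.

A functional of norm 1 with value 1 at `p` also has value 1 at every norm-one `f` in the space with
`f * conj p ≥ 0` on the circle (`apply_eq_one_of_nonneg`). The functional given by integration
against `conj p / |p|` has value 1 on the ball at exactly those `f` (`exists_functional`). So `p` is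
exposed iff it is the only such `f` (`isExposedPointOfBall_iff`).

If `f * conj p` is real on the circle, then `f p* = f* p` as polynomials. Comparing multiplicities
off the circle, and using sign changes at odd zeros on it, gives `R̃ ∣ f` (`RTilde_dvd`). Comparing
multiplicities at 0, where reflected polynomials record degree deficits, gives `deg Q ≤ 2 m̃` for `Q
= f / R̃`. Since `G̃` is `z^m̃` times a nonnegative function on the circle, positivity of `f * conj
p` becomes positivity of the trigonometric polynomial `z^(-m̃) Q`, which is a plus-vector. The
vanishing of the coefficients of `R̃ Q` at the `k_j` is the kernel condition (`mem_NTilde_iff`).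

Thus the admissible `f`, with norm unrestricted, form a cone that matches the plus-vectors of `Ñ`
(`mem_fewnomials_and_nonneg_iff`). It contains `p`, and uniqueness at norm 1 says that it is a
single ray, i.e. that the plus-dimension is 1. -/

theorem pstar_ne_zero {N : ℕ} {f : ℂ[X]} (hf : f ≠ 0) : pstar N f ≠ 0 := by
  rw [pstar, Ne, reflect_eq_zero_iff]
  exact (Polynomial.map_ne_zero_iff (starRingEnd ℂ).injective).2 hf

theorem coeff_pstar (N : ℕ) (f : ℂ[X]) {i : ℕ} (hi : i ≤ N) :
    (pstar N f).coeff i = starRingEnd ℂ (f.coeff (N - i)) := by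
  simp [pstar, revAt_le hi]

theorem natDegree_pstar_le {N : ℕ} {f : ℂ[X]} (hf : f.natDegree ≤ N) :
    (pstar N f).natDegree ≤ N := by
  refine natDegree_reflect_le.trans ?_
  simpa [natDegree_map] using hf

theorem pstar_pstar (N : ℕ) (f : ℂ[X]) : pstar N (pstar N f) = f := by
  ext i
  simp [pstar]

theorem pstar_mul {A B : ℕ} {f g : ℂ[X]} (hf : f.natDegree ≤ A) (hg : g.natDegree ≤ B) :
    pstar (A + B) (f * g) = pstar A f * pstar B g := by
  simp only [pstar, Polynomial.map_mul]
  exact reflect_mul _ _ (by simpa [natDegree_map] using hf) (by simpa [natDegree_map] using hg)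

theorem natDegree_X_sub_C_pow (a : ℂ) (r : ℕ) : ((X - C a) ^ r).natDegree = r := by simp

theorem natDegree_one_sub_C_mul_X_le (a : ℂ) : (1 - C a * X).natDegree ≤ 1 := by
  compute_degree

theorem pstar_X_sub_C_pow (a : ℂ) (r : ℕ) :
    pstar r ((X - C a) ^ r) = (1 - C (starRingEnd ℂ a) * X) ^ r := by
  induction r with
  | zero => simp [pstar]
  | succ r ih =>
    rw [pow_succ, pstar_mul (natDegree_X_sub_C_pow a r).le (natDegree_X_sub_C a).le, ih, pow_succ]
    congr 1
    simp [pstar, reflect_sub]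

theorem pstar_one_sub_C_mul_X_pow (a : ℂ) (r : ℕ) :
    pstar r ((1 - C (starRingEnd ℂ a) * X) ^ r) = (X - C a) ^ r := by
  rw [← pstar_X_sub_C_pow, pstar_pstar]

/-- On the unit circle `p*(z) = z^N conj (p z)`. -/
theorem eval_pstar {N : ℕ} {f : ℂ[X]} (hf : f.natDegree ≤ N) {z : ℂ} (hz : ‖z‖ = 1) :
    (pstar N f).eval z = z ^ N * starRingEnd ℂ (f.eval z) := by
  have hz0 : z ≠ 0 := by rintro rfl; simp at hz
  have hinv : starRingEnd ℂ z = z⁻¹ := (Complex.inv_eq_conj hz).symm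
  let : Invertible z⁻¹ := invertibleOfNonzero (inv_ne_zero hz0)
  have h := eval₂_reflect_mul_pow (RingHom.id ℂ) z⁻¹ N (f.map (starRingEnd ℂ))
    (by simpa [natDegree_map] using hf)
  rw [invOf_eq_inv, inv_inv] at h
  have h2 : eval₂ (RingHom.id ℂ) z⁻¹ (f.map (starRingEnd ℂ)) = starRingEnd ℂ (f.eval z) := by
    rw [← hinv]
    change eval _ _ = _
    rw [eval_map, eval₂_hom]
  rw [h2] at h
  rw [← h, pstar, eval, mul_comm, mul_assoc, ← mul_pow, inv_mul_cancel₀ hz0, one_pow, mul_one]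

/-- Reflection at level `N` turns the degree deficit of `f` (its zero at infinity) into a zero at
the origin. All degree bounds below come from this. -/
theorem rootMultiplicity_zero_pstar {N : ℕ} {f : ℂ[X]} (hf : f ≠ 0) (hN : f.natDegree ≤ N) :
    (pstar N f).rootMultiplicity 0 + f.natDegree = N := by
  rw [rootMultiplicity_eq_natTrailingDegree']
  have h : (pstar N f).natTrailingDegree = N - f.natDegree := by
    apply le_antisymm
    · apply natTrailingDegree_le_of_ne_zero
      rw [coeff_pstar _ _ (Nat.sub_le _ _), Nat.sub_sub_self hN]
      simpa using hf
    · apply le_natTrailingDegree (pstar_ne_zero hf)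
      intro i hi
      rw [coeff_pstar _ _ (by omega), coeff_eq_zero_of_natDegree_lt (by omega), map_zero]
  omega

theorem rootMultiplicity_le_pstar {N : ℕ} {f : ℂ[X]} (hf : f ≠ 0) (hN : f.natDegree ≤ N) {a : ℂ}
    (ha : a ≠ 0) :
    f.rootMultiplicity a ≤ (pstar N f).rootMultiplicity (starRingEnd ℂ a)⁻¹ := by
  have hca : starRingEnd ℂ a ≠ 0 := by simpa using ha
  rw [le_rootMultiplicity_iff (pstar_ne_zero hf)]
  obtain ⟨u, hu⟩ := pow_rootMultiplicity_dvd f a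
  set r := f.rootMultiplicity a
  have hu0 : u ≠ 0 := by rintro rfl; simp at hu; exact hf hu
  have hdeg : r + u.natDegree = f.natDegree := by
    conv_rhs => rw [hu]
    rw [natDegree_mul (pow_ne_zero _ (X_sub_C_ne_zero a)) hu0, natDegree_X_sub_C_pow]
  -- Reflecting the factor `(z - a)^r` separately gives `(1 - conj(a) z)^r`, which vanishes to order
  -- `r` at the mirror point.
  have h : pstar N f = (1 - C (starRingEnd ℂ a) * X) ^ r * pstar (N - r) u := by
    rw [← pstar_X_sub_C_pow, ← pstar_mul (natDegree_X_sub_C_pow a r).le (by omega), ← hu]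
    congr 1
    omega
  rw [h]
  refine Dvd.dvd.mul_right (pow_dvd_pow_of_dvd ⟨C (-starRingEnd ℂ a), ?_⟩ r) _
  rw [sub_mul, ← C_mul]
  simp [hca]
  ring

/-- Reflection in the unit circle carries the zeros of `f` to those of `f*`. -/
theorem rootMultiplicity_pstar {N : ℕ} {f : ℂ[X]} (hf : f ≠ 0) (hN : f.natDegree ≤ N) {a : ℂ}
    (ha : a ≠ 0) :
    (pstar N f).rootMultiplicity (starRingEnd ℂ a)⁻¹ = f.rootMultiplicity a := by
  refine le_antisymm ?_ (rootMultiplicity_le_pstar hf hN ha)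
  have h := rootMultiplicity_le_pstar (pstar_ne_zero (N := N) hf) (natDegree_pstar_le hN)
    (a := (starRingEnd ℂ a)⁻¹) (by simpa using ha)
  simpa [pstar_pstar] using h

theorem dvd_of_rootMultiplicity_le {f g : ℂ[X]} (hf : f ≠ 0) (hg : g ≠ 0)
    (h : ∀ a, f.rootMultiplicity a ≤ g.rootMultiplicity a) : f ∣ g := by
  classical
  rw [IsAlgClosed.dvd_iff_roots_le_roots hf hg, Multiset.le_iff_count]
  simpa [count_roots] using h

theorem rootMultiplicity_pow (f : ℂ[X]) (a : ℂ) (r : ℕ) :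
    (f ^ r).rootMultiplicity a = r * f.rootMultiplicity a := by
  classical
  rw [← count_roots, roots_pow, Multiset.count_nsmul, count_roots]

theorem rootMultiplicity_prod {ι : Type*} (s : Finset ι) (f : ι → ℂ[X]) (hf : ∀ i ∈ s, f i ≠ 0)
    (a : ℂ) : (∏ i ∈ s, f i).rootMultiplicity a = ∑ i ∈ s, (f i).rootMultiplicity a := by
  classical
  induction s using Finset.induction_on with
  | empty => simp
  | insert i s hi ih =>
    have h' : ∀ j ∈ s, f j ≠ 0 := fun j hj => hf j (Finset.mem_insert_of_mem hj)
    rw [Finset.prod_insert hi, Finset.sum_insert hi, rootMultiplicity_mul, ih h']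
    exact mul_ne_zero (hf i (Finset.mem_insert_self _ _)) (Finset.prod_ne_zero_iff.2 h')

/-! ### Self-reciprocal products -/

/-- The product of `((z - b)(1 - conj(b) z))^(e b)` over `b ∈ s`. -/
noncomputable def reciprocalProd (s : Finset ℂ) (e : ℂ → ℕ) : ℂ[X] :=
  ∏ b ∈ s, (X - C b) ^ e b * (1 - C (starRingEnd ℂ b) * X) ^ e b

theorem one_sub_C_mul_X_ne_zero (b : ℂ) : (1 - C b * X : ℂ[X]) ≠ 0 := by
  intro h
  simpa using congrArg (fun q => q.eval 0) h

theorem reciprocalProd_ne_zero (s : Finset ℂ) (e : ℂ → ℕ) : reciprocalProd s e ≠ 0 :=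
  Finset.prod_ne_zero_iff.2 fun b _ => mul_ne_zero (pow_ne_zero _ (X_sub_C_ne_zero b))
    (pow_ne_zero _ (one_sub_C_mul_X_ne_zero _))

theorem natDegree_reciprocalFactor_le (b : ℂ) (r : ℕ) :
    ((X - C b) ^ r * (1 - C (starRingEnd ℂ b) * X) ^ r).natDegree ≤ r + r := by
  refine natDegree_mul_le.trans (add_le_add (natDegree_X_sub_C_pow b r).le ?_)
  simpa using natDegree_pow_le_of_le r (natDegree_one_sub_C_mul_X_le (starRingEnd ℂ b))

theorem natDegree_reciprocalProd_le (s : Finset ℂ) (e : ℂ → ℕ) :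
    (reciprocalProd s e).natDegree ≤ 2 * ∑ b ∈ s, e b := by
  refine (natDegree_prod_le _ _).trans ?_
  rw [Finset.mul_sum]
  exact Finset.sum_le_sum fun b _ => by
    rw [two_mul]; exact natDegree_reciprocalFactor_le b (e b)

/-- The reflection level is the nominal degree: for `b = 0` the factor `1 - conj(b) z` is constant,
so the true degree can be smaller. -/
theorem pstar_reciprocalProd (s : Finset ℂ) (e : ℂ → ℕ) :
    pstar (2 * ∑ b ∈ s, e b) (reciprocalProd s e) = reciprocalProd s e := by
  classical
  induction s using Finset.induction_on with
  | empty => simp [reciprocalProd, pstar]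
  | insert b s hb ih =>
    have h : reciprocalProd (insert b s) e =
        (X - C b) ^ e b * (1 - C (starRingEnd ℂ b) * X) ^ e b * reciprocalProd s e :=
      Finset.prod_insert hb
    rw [h, Finset.sum_insert hb, mul_add, two_mul (e b),
      pstar_mul (natDegree_reciprocalFactor_le b (e b)) (natDegree_reciprocalProd_le s e), ih,
      pstar_mul (natDegree_X_sub_C_pow b (e b)).le, pstar_X_sub_C_pow, pstar_one_sub_C_mul_X_pow,
      mul_comm ((X - C b) ^ e b)]
    simpa using natDegree_pow_le_of_le (e b) (natDegree_one_sub_C_mul_X_le (starRingEnd ℂ b))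

/-- On the circle `(z - b)(1 - conj(b) z) = z |z - b|²`. -/
theorem eval_reciprocalProd (s : Finset ℂ) (e : ℂ → ℕ) {z : ℂ} (hz : ‖z‖ = 1) :
    ∃ g : ℝ, 0 ≤ g ∧ (reciprocalProd s e).eval z = z ^ (∑ b ∈ s, e b) * g := by
  refine ⟨∏ b ∈ s, ‖z - b‖ ^ (2 * e b), Finset.prod_nonneg fun b _ => by positivity, ?_⟩
  have hinv : z * starRingEnd ℂ z = 1 := by
    rw [Complex.mul_conj', hz]
    simp
  rw [reciprocalProd, eval_prod, ← Finset.prod_pow_eq_pow_sum, Complex.ofReal_prod,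
    ← Finset.prod_mul_distrib]
  refine Finset.prod_congr rfl fun b _ => ?_
  have h : (z - b) * (1 - starRingEnd ℂ b * z) = z * ((‖z - b‖ : ℂ)) ^ 2 := by
    rw [← Complex.mul_conj', map_sub]
    linear_combination -(z - b) * hinv
  simp only [eval_mul, eval_pow, eval_sub, eval_X, eval_C, eval_one, Complex.ofReal_pow]
  rw [← mul_pow, h, mul_pow, pow_mul]

theorem rootMultiplicity_one_sub_C_mul_X {a b : ℂ} (ha : ‖a‖ ≤ 1) (hb : ‖b‖ ≤ 1) :
    (1 - C (starRingEnd ℂ b) * X).rootMultiplicity a =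
      open Classical in if a = b ∧ ‖b‖ = 1 then 1 else 0 := by
  split_ifs with h
  · obtain ⟨rfl, h⟩ := h
    have ha0 : starRingEnd ℂ a ≠ 0 := by
      intro h0
      rw [map_eq_zero] at h0
      simp [h0] at h
    have hinv : starRingEnd ℂ a * a = 1 := by
      rw [Complex.conj_mul', h]; simp
    have : (1 - C (starRingEnd ℂ a) * X : ℂ[X]) = C (-starRingEnd ℂ a) * (X - C a) := by
      rw [mul_sub, ← C_mul, neg_mul, hinv]
      simp
      ring
    rw [this, rootMultiplicity_mul (mul_ne_zero (by simpa using ha0) (X_sub_C_ne_zero a)),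
      rootMultiplicity_C, zero_add, rootMultiplicity_X_sub_C_self]
  · apply rootMultiplicity_eq_zero
    intro h0
    have h1 : starRingEnd ℂ b * a = 1 := by
      simp [IsRoot] at h0
      linear_combination -h0
    have h2 : ‖b‖ * ‖a‖ = 1 := by
      have := congrArg norm h1
      simpa using this
    have hb1 : ‖b‖ = 1 := by nlinarith [norm_nonneg a, norm_nonneg b]
    refine h ⟨?_, hb1⟩
    have h3 : b * starRingEnd ℂ b = 1 := by
      rw [Complex.mul_conj', hb1]; simp
    linear_combination b * h1 - a * h3

/-- In the closed disk `1 - conj(b) z` can vanish only at `b` itself, and only if `|b| = 1`; hence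
the doubling on the circle. -/
theorem rootMultiplicity_reciprocalProd {s : Finset ℂ} (hs : ∀ b ∈ s, ‖b‖ ≤ 1) (e : ℂ → ℕ) {a : ℂ}
    (ha : ‖a‖ ≤ 1) :
    (reciprocalProd s e).rootMultiplicity a =
      open Classical in if a ∈ s then (if ‖a‖ = 1 then 2 * e a else e a) else 0 := by
  classical
  rw [reciprocalProd, rootMultiplicity_prod]
  · have : ∀ b ∈ s, ((X - C b) ^ e b * (1 - C (starRingEnd ℂ b) * X) ^ e b).rootMultiplicity a =
        if b = a then (if ‖a‖ = 1 then 2 * e a else e a) else 0 := by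
      intro b hb
      rw [rootMultiplicity_mul (mul_ne_zero (pow_ne_zero _ (X_sub_C_ne_zero b))
        (pow_ne_zero _ (one_sub_C_mul_X_ne_zero _))), rootMultiplicity_pow,
        rootMultiplicity_pow, rootMultiplicity_X_sub_C,
        rootMultiplicity_one_sub_C_mul_X ha (hs b hb)]
      by_cases hab : a = b
      · subst hab
        by_cases h1 : ‖a‖ = 1 <;> simp [h1]
        ring
      · simp [hab, Ne.symm hab]
    rw [Finset.sum_congr rfl this, Finset.sum_ite_eq']
  · exact fun b _ => mul_ne_zero (pow_ne_zero _ (X_sub_C_ne_zero b))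
      (pow_ne_zero _ (one_sub_C_mul_X_ne_zero _))

/-! ### The factorization `p = G̃ R̃` -/

theorem GTilde_eq (N : ℕ) (p : ℂ[X]) :
    GTilde N p = reciprocalProd (diskZeros N p) (diskMult N p) *
      reciprocalProd (circleZeros p) (circleMult p) := rfl

theorem GTilde_ne_zero (N : ℕ) (p : ℂ[X]) : GTilde N p ≠ 0 :=
  mul_ne_zero (reciprocalProd_ne_zero _ _) (reciprocalProd_ne_zero _ _)

theorem natDegree_GTilde_le (N : ℕ) (p : ℂ[X]) : (GTilde N p).natDegree ≤ 2 * mTilde N p := by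
  rw [GTilde_eq, mTilde, mul_add]
  exact natDegree_mul_le.trans
    (add_le_add (natDegree_reciprocalProd_le _ _) (natDegree_reciprocalProd_le _ _))

theorem pstar_GTilde (N : ℕ) (p : ℂ[X]) : pstar (2 * mTilde N p) (GTilde N p) = GTilde N p := by
  rw [GTilde_eq, mTilde, mul_add,
    pstar_mul (natDegree_reciprocalProd_le _ _) (natDegree_reciprocalProd_le _ _),
    pstar_reciprocalProd, pstar_reciprocalProd]

theorem eval_GTilde (N : ℕ) (p : ℂ[X]) {z : ℂ} (hz : ‖z‖ = 1) :
    ∃ g : ℝ, 0 ≤ g ∧ (GTilde N p).eval z = z ^ mTilde N p * g := by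
  obtain ⟨g₁, h₁, e₁⟩ := eval_reciprocalProd (diskZeros N p) (diskMult N p) hz
  obtain ⟨g₂, h₂, e₂⟩ := eval_reciprocalProd (circleZeros p) (circleMult p) hz
  refine ⟨g₁ * g₂, mul_nonneg h₁ h₂, ?_⟩
  rw [GTilde_eq, eval_mul, e₁, e₂, mTilde, pow_add]
  push_cast
  ring

theorem rootMultiplicity_GTilde_of_norm_lt {N : ℕ} {p : ℂ[X]} (hp : p ≠ 0) {a : ℂ}
    (ha : ‖a‖ < 1) :
    (GTilde N p).rootMultiplicity a =
      min (p.rootMultiplicity a) ((pstar N p).rootMultiplicity a) := by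
  classical
  rw [GTilde_eq, rootMultiplicity_mul (mul_ne_zero (reciprocalProd_ne_zero _ _)
    (reciprocalProd_ne_zero _ _)),
    rootMultiplicity_reciprocalProd (fun b hb => ?_) _ ha.le,
    rootMultiplicity_reciprocalProd (fun b hb => ?_) _ ha.le]
  · have h1 : a ∉ circleZeros p := by simp [circleZeros, ha.ne]
    rw [if_neg h1, if_neg ha.ne, add_zero]
    split_ifs with h
    · rfl
    · simp only [diskZeros, Finset.mem_filter, Multiset.mem_toFinset, mem_roots hp, ha, and_true,
        not_and_or] at h
      rcases h with h | h <;> simp [rootMultiplicity_eq_zero h]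
  · simp only [circleZeros, Finset.mem_filter] at hb
    exact hb.2.le
  · simp only [diskZeros, Finset.mem_filter] at hb
    exact hb.2.2.le

theorem rootMultiplicity_GTilde_of_norm_eq {N : ℕ} {p : ℂ[X]} (hp : p ≠ 0) {a : ℂ}
    (ha : ‖a‖ = 1) :
    (GTilde N p).rootMultiplicity a = 2 * (p.rootMultiplicity a / 2) := by
  classical
  rw [GTilde_eq, rootMultiplicity_mul (mul_ne_zero (reciprocalProd_ne_zero _ _)
    (reciprocalProd_ne_zero _ _)),
    rootMultiplicity_reciprocalProd (fun b hb => ?_) _ ha.le,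
    rootMultiplicity_reciprocalProd (fun b hb => ?_) _ ha.le]
  · have h1 : a ∉ diskZeros N p := by simp [diskZeros, ha]
    rw [if_neg h1, if_pos ha, zero_add]
    split_ifs with h
    · rfl
    · simp only [circleZeros, Finset.mem_filter, Multiset.mem_toFinset, mem_roots hp, ha,
        and_true] at h
      simp [rootMultiplicity_eq_zero h]
  · simp only [circleZeros, Finset.mem_filter] at hb
    exact hb.2.le
  · simp only [diskZeros, Finset.mem_filter] at hb
    exact hb.2.2.le

theorem rootMultiplicity_GTilde_of_norm_ne {N : ℕ} {p : ℂ[X]} (hp : p ≠ 0) (hN : p.natDegree ≤ N)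
    {a : ℂ} (ha : ‖a‖ ≠ 1) :
    (GTilde N p).rootMultiplicity a =
      min (p.rootMultiplicity a) ((pstar N p).rootMultiplicity a) := by
  rcases ha.lt_or_gt with h | h
  · exact rootMultiplicity_GTilde_of_norm_lt hp h
  · have ha0 : a ≠ 0 := by rintro rfl; simp at h; linarith
    have hb : ‖(starRingEnd ℂ a)⁻¹‖ < 1 := by
      rw [norm_inv, RCLike.norm_conj]; exact inv_lt_one_of_one_lt₀ h
    -- Outside the disk, pass to the mirror point: `G̃` is self-reciprocal, while `p` and `p*` trade
    -- places, which leaves the minimum unchanged.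
    have h1 := rootMultiplicity_pstar (GTilde_ne_zero N p) (natDegree_GTilde_le N p) ha0
    have h2 := rootMultiplicity_pstar hp hN ha0
    have h3 := rootMultiplicity_pstar (pstar_ne_zero (N := N) hp) (natDegree_pstar_le hN) ha0
    rw [pstar_GTilde] at h1
    rw [pstar_pstar] at h3
    rw [← h1, rootMultiplicity_GTilde_of_norm_lt hp hb, h2, h3, min_comm]

theorem GTilde_dvd {N : ℕ} {p : ℂ[X]} (hp : p ≠ 0) (hN : p.natDegree ≤ N) : GTilde N p ∣ p := by
  refine dvd_of_rootMultiplicity_le (GTilde_ne_zero N p) hp fun a => ?_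
  by_cases ha : ‖a‖ = 1
  · rw [rootMultiplicity_GTilde_of_norm_eq hp ha]; omega
  · rw [rootMultiplicity_GTilde_of_norm_ne hp hN ha]; exact min_le_left _ _

theorem GTilde_mul_RTilde {N : ℕ} {p : ℂ[X]} (hp : p ≠ 0) (hN : p.natDegree ≤ N) :
    GTilde N p * RTilde N p = p :=
  EuclideanDomain.mul_div_cancel' (GTilde_ne_zero N p) (GTilde_dvd hp hN)

theorem RTilde_ne_zero {N : ℕ} {p : ℂ[X]} (hp : p ≠ 0) (hN : p.natDegree ≤ N) :
    RTilde N p ≠ 0 := by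
  intro h
  have := GTilde_mul_RTilde hp hN
  rw [h, mul_zero] at this
  exact hp this.symm

theorem natDegree_GTilde_add_RTilde {N : ℕ} {p : ℂ[X]} (hp : p ≠ 0) (hN : p.natDegree ≤ N) :
    (GTilde N p).natDegree + (RTilde N p).natDegree = p.natDegree := by
  rw [← natDegree_mul (GTilde_ne_zero N p) (RTilde_ne_zero hp hN), GTilde_mul_RTilde hp hN]

/-- At the origin `G̃` has multiplicity `2 m̃ - deg G̃`, which is at most that of `p*`, namely `N -
deg p`. -/
theorem two_mul_mTilde_add_natDegree_RTilde_le {N : ℕ} {p : ℂ[X]} (hp : p ≠ 0)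
    (hN : p.natDegree ≤ N) : 2 * mTilde N p + (RTilde N p).natDegree ≤ N := by
  have h1 := rootMultiplicity_zero_pstar (GTilde_ne_zero N p) (natDegree_GTilde_le N p)
  have h2 := rootMultiplicity_zero_pstar hp hN
  have h3 := natDegree_GTilde_add_RTilde hp hN
  have h4 := rootMultiplicity_GTilde_of_norm_lt (N := N) hp (a := 0) (by simp)
  rw [pstar_GTilde] at h1
  omega

/-- If `f p* = f* p`, and `f` vanishes at the zeros of odd order of `p` on the circle, then `R̃`
divides `f`. -/
theorem RTilde_dvd {N : ℕ} {p f : ℂ[X]} (hp : p ≠ 0) (hN : p.natDegree ≤ N) (hf : f ≠ 0)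
    (h : f * pstar N p = pstar N f * p)
    (hodd : ∀ a, ‖a‖ = 1 → Odd (p.rootMultiplicity a) → f.IsRoot a) : RTilde N p ∣ f := by
  refine dvd_of_rootMultiplicity_le (RTilde_ne_zero hp hN) hf fun a => ?_
  have hG : (GTilde N p).rootMultiplicity a + (RTilde N p).rootMultiplicity a =
      p.rootMultiplicity a := by
    rw [← rootMultiplicity_mul (mul_ne_zero (GTilde_ne_zero N p) (RTilde_ne_zero hp hN)),
      GTilde_mul_RTilde hp hN]
  have hm := congrArg (rootMultiplicity a) h
  rw [rootMultiplicity_mul (mul_ne_zero hf (pstar_ne_zero hp)),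
    rootMultiplicity_mul (mul_ne_zero (pstar_ne_zero hf) hp)] at hm
  -- On the circle `R̃` has multiplicity 0 or 1, the parity of that of `p`. Off the circle its
  -- multiplicity is the excess of `p` over `p*`, which `hm` forces into `f`.
  by_cases ha : ‖a‖ = 1
  · rw [rootMultiplicity_GTilde_of_norm_eq hp ha] at hG
    rcases Nat.even_or_odd (p.rootMultiplicity a) with he | ho
    · have := Nat.even_iff.1 he
      omega
    · have := (rootMultiplicity_pos hf).2 (hodd a ha ho)
      omega
  · rw [rootMultiplicity_GTilde_of_norm_ne hp hN ha] at hG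
    omega

theorem natDegree_le_of_eq_mul_RTilde {N : ℕ} {p f Q : ℂ[X]} (hp : p ≠ 0) (hN : p.natDegree ≤ N)
    (hf : f ≠ 0) (hfN : f.natDegree ≤ N) (h : f * pstar N p = pstar N f * p)
    (hQ : f = RTilde N p * Q) : Q.natDegree ≤ 2 * mTilde N p := by
  have hR := RTilde_ne_zero hp hN
  have hQ0 : Q ≠ 0 := by rintro rfl; simp at hQ; exact hf hQ
  have h1 := rootMultiplicity_zero_pstar (GTilde_ne_zero N p) (natDegree_GTilde_le N p)
  rw [pstar_GTilde] at h1
  have h2 := rootMultiplicity_zero_pstar hp hN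
  have h3 := rootMultiplicity_zero_pstar hf hfN
  have h4 := natDegree_GTilde_add_RTilde hp hN
  have h5 : f.natDegree = (RTilde N p).natDegree + Q.natDegree := by
    rw [hQ, natDegree_mul hR hQ0]
  -- Cancelling `R̃` and counting zeros at the origin, each reflected factor contributes its degree
  -- deficit; the balance is `ord₀ Q + deg Q = 2 m̃`.
  have h6 : Q * pstar N p = pstar N f * GTilde N p := by
    apply mul_left_cancel₀ hR
    calc RTilde N p * (Q * pstar N p) = f * pstar N p := by rw [hQ]; ring
      _ = pstar N f * (GTilde N p * RTilde N p) := by rw [h, GTilde_mul_RTilde hp hN]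
      _ = _ := by ring
  have h7 := congrArg (rootMultiplicity 0) h6
  rw [rootMultiplicity_mul (mul_ne_zero hQ0 (pstar_ne_zero hp)),
    rootMultiplicity_mul (mul_ne_zero (pstar_ne_zero hf) (GTilde_ne_zero N p))] at h7
  omega

/-! ### Polynomials on the unit circle -/

theorem infinite_unitCircle : {z : ℂ | ‖z‖ = 1}.Infinite := by
  have h : IsConnected (Metric.sphere (0 : ℂ) 1) :=
    isConnected_sphere (by rw [Complex.rank_real_complex]; norm_num) 0 zero_le_one
  have h2 : (Metric.sphere (0 : ℂ) 1).Nontrivial := ⟨1, by simp, -1, by simp, by norm_num⟩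
  simpa [Metric.sphere] using h.isPreconnected.infinite_of_nontrivial h2

theorem eq_of_eval_eq_on_circle {f g : ℂ[X]} (h : ∀ z : ℂ, ‖z‖ = 1 → f.eval z = g.eval z) :
    f = g :=
  eq_of_infinite_eval_eq f g (infinite_unitCircle.mono fun z hz => h z hz)

theorem exists_toCircle_eq {z : ℂ} (hz : ‖z‖ = 1) :
    ∃ t ∈ Set.Ioc (-π) π, (AddCircle.toCircle ((t : ℝ) : Arc) : ℂ) = z ∧
      Complex.exp (t * Complex.I) = z := by
  have h : Complex.exp (z.arg * Complex.I) = z := by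
    have := Complex.norm_mul_exp_arg_mul_I z
    rwa [hz, Complex.ofReal_one, one_mul] at this
  refine ⟨z.arg, Complex.arg_mem_Ioc z, ?_, h⟩
  rw [AddCircle.toCircle_apply_mk, Circle.coe_exp]
  simpa using h

theorem ae_eval_ne_zero {p : ℂ[X]} (hp : p ≠ 0) :
    ∀ᵐ t : Arc ∂AddCircle.haarAddCircle, p.eval (AddCircle.toCircle t : ℂ) ≠ 0 := by
  classical
  have hfin : {t : Arc | p.eval (AddCircle.toCircle t : ℂ) = 0}.Finite := by
    have hinj : Function.Injective fun t : Arc => (AddCircle.toCircle t : ℂ) :=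
      Subtype.val_injective.comp (AddCircle.injective_toCircle Real.two_pi_pos.ne')
    refine ((p.roots.toFinset.finite_toSet).preimage hinj.injOn).subset fun t ht => ?_
    simpa [hp] using ht
  rw [ae_iff]
  simp only [not_not]
  -- A point is a closed ball of radius 0, whose arc length is 0.
  have : NullSingletonClass (volume : Measure Arc) := ⟨fun x => by
    rw [← Metric.closedBall_zero, AddCircle.volume_closedBall]
    simp [Real.two_pi_pos.le]⟩
  have h0 : (volume : Measure Arc) {t : Arc | p.eval (AddCircle.toCircle t : ℂ) = 0} = 0 :=
    hfin.measure_zero _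
  rw [AddCircle.volume_eq_smul_haarAddCircle, Measure.smul_apply, smul_eq_mul, mul_eq_zero] at h0
  refine h0.resolve_left ?_
  simpa using Real.two_pi_pos

/-- A set of full Haar measure is dense, and the set where a continuous function is nonnegative is
closed. -/
theorem nonneg_on_circle_of_ae {F : ℂ → ℂ} (hF : Continuous F)
    (h : ∀ᵐ t : Arc ∂AddCircle.haarAddCircle, 0 ≤ F (AddCircle.toCircle t : ℂ)) {z : ℂ}
    (hz : ‖z‖ = 1) : 0 ≤ F z := by
  have hc : IsClosed {t : Arc | 0 ≤ F (AddCircle.toCircle t : ℂ)} :=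
    isClosed_le continuous_const
      (hF.comp (continuous_subtype_val.comp AddCircle.continuous_toCircle))
  obtain ⟨t, -, ht, -⟩ := exists_toCircle_eq hz
  have := hc.closure_subset_iff.2 subset_rfl (Measure.dense_of_ae h (t : Arc))
  rw [← ht]
  exact this

/-- A continuous function on the circle that is nonnegative off the zeros of a polynomial is
nonnegative. -/
theorem nonneg_of_nonneg_off_zeros {p : ℂ[X]} (hp : p ≠ 0) {F : ℂ → ℂ} (hF : Continuous F)
    (h : ∀ z, ‖z‖ = 1 → p.eval z ≠ 0 → 0 ≤ F z) {z : ℂ} (hz : ‖z‖ = 1) : 0 ≤ F z :=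
  nonneg_on_circle_of_ae hF
    ((ae_eval_ne_zero hp).mono fun _ ht => h _ (Circle.norm_coe _) ht) hz

theorem nonneg_of_mul_ofReal_nonneg {w : ℂ} {c : ℝ} (hc : 0 < c) (h : 0 ≤ w * (c : ℂ)) :
    0 ≤ w := by
  rw [Complex.nonneg_iff, Complex.re_mul_ofReal, Complex.im_mul_ofReal] at h
  refine Complex.nonneg_iff.2 ⟨nonneg_of_mul_nonneg_left h.1 hc, ?_⟩
  exact ((mul_eq_zero.1 h.2.symm).resolve_right hc.ne').symm

theorem self_mul_conj_nonneg (w : ℂ) : 0 ≤ w * starRingEnd ℂ w := mul_star_self_nonneg w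

/-- If `f conj(p) ≥ 0` on the circle, then `f` vanishes at every zero of odd order of `p` there. -/
theorem isRoot_of_odd_of_nonneg {p f : ℂ[X]} (hp : p ≠ 0)
    (h : ∀ z : ℂ, ‖z‖ = 1 → 0 ≤ f.eval z * starRingEnd ℂ (p.eval z)) {a : ℂ} (ha : ‖a‖ = 1)
    (hodd : Odd (p.rootMultiplicity a)) : f.IsRoot a := by
  obtain ⟨u, hu, hua⟩ := exists_eq_pow_rootMultiplicity_mul_and_not_dvd p hp a
  set r := p.rootMultiplicity a
  rw [dvd_iff_isRoot, IsRoot.def] at hua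
  let e : ℝ → ℂ := fun t => Complex.exp (t * Complex.I)
  have he : Continuous e := by fun_prop
  -- With `z = a e^(2it)` one has `z - a = 2i a e^(it) sin t`, so `f conj(p) = F(t) sin^r t` with
  -- `F` continuous. As `r` is odd, `sin^r` changes sign at 0, which forces `F 0 = 0`; the other
  -- factor of `F 0` is nonzero.
  let F : ℝ → ℂ := fun t => f.eval (a * e t ^ 2) *
    starRingEnd ℂ (u.eval (a * e t ^ 2) * (a * e t * (2 * Complex.I)) ^ r)
  have hF : Continuous F := by
    have h1 : Continuous fun t => a * e t ^ 2 := by fun_prop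
    have h2 := f.continuous.comp h1
    have h3 := u.continuous.comp h1
    exact h2.mul (Complex.continuous_conj.comp (h3.mul (by fun_prop)))
  have hpos : ∀ t : ℝ, 0 ≤ F t * ((Real.sin t ^ r : ℝ) : ℂ) := by
    intro t
    have hz : ‖a * e t ^ 2‖ = 1 := by simp [e, ha, Complex.norm_exp_ofReal_mul_I]
    have h1 : a * e t ^ 2 - a = a * e t * (2 * Complex.I) * (Real.sin t : ℂ) := by
      simp only [e, Complex.exp_mul_I, Complex.ofReal_sin]
      have := Complex.sin_sq_add_cos_sq (t : ℂ)
      linear_combination a * this - a * Complex.sin t ^ 2 * Complex.I_sq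
    have h2 := h _ hz
    have h3 : p.eval (a * e t ^ 2) =
        (a * e t * (2 * Complex.I) * (Real.sin t : ℂ)) ^ r * u.eval (a * e t ^ 2) := by
      conv_lhs => rw [hu]
      rw [eval_mul, eval_pow, eval_sub, eval_X, eval_C, h1]
    rw [h3] at h2
    convert h2 using 1
    simp only [F, map_mul, map_pow, mul_pow, Complex.conj_ofReal, Complex.ofReal_pow]
    ring
  have hge : 0 ≤ F 0 := by
    have : ∀ᶠ t in nhdsWithin (0 : ℝ) (Set.Ioi 0), 0 ≤ F t := by
      filter_upwards [Ioo_mem_nhdsGT Real.pi_pos] with t ht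
      have hs : 0 < Real.sin t ^ r := pow_pos (Real.sin_pos_of_mem_Ioo ht) _
      exact nonneg_of_mul_ofReal_nonneg hs (hpos t)
    exact ge_of_tendsto ((hF.tendsto 0).mono_left nhdsWithin_le_nhds) this
  have hle : F 0 ≤ 0 := by
    have : ∀ᶠ t in nhdsWithin (0 : ℝ) (Set.Iio 0), F t ≤ 0 := by
      filter_upwards [Ioo_mem_nhdsLT (neg_lt_zero.2 Real.pi_pos)] with t ht
      have hs : Real.sin t ^ r < 0 :=
        hodd.pow_neg (Real.sin_neg_of_neg_of_neg_pi_lt ht.2 ht.1)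
      have := hpos t
      rw [Complex.nonneg_iff] at this
      rw [Complex.nonpos_iff]
      simp only [Complex.re_mul_ofReal, Complex.im_mul_ofReal] at this
      exact ⟨by nlinarith [this.1],
        by simpa [hs.ne] using this.2.symm⟩
    exact le_of_tendsto ((hF.tendsto 0).mono_left nhdsWithin_le_nhds) this
  have h0 : F 0 = 0 := le_antisymm hle hge
  have ha0 : a ≠ 0 := by rintro rfl; simp at ha
  simpa [F, e, hua, ha0, Complex.I_ne_zero] using h0

/-- Only the reality of `f conj(p)` matters: `f conj(p) = conj(f) p`, multiplied by `z^N`, is the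
identity on the circle. -/
theorem mul_pstar_eq_of_nonneg {N : ℕ} {p f : ℂ[X]} (hN : p.natDegree ≤ N) (hfN : f.natDegree ≤ N)
    (h : ∀ z : ℂ, ‖z‖ = 1 → 0 ≤ f.eval z * starRingEnd ℂ (p.eval z)) :
    f * pstar N p = pstar N f * p := by
  refine eq_of_eval_eq_on_circle fun z hz => ?_
  rw [eval_mul, eval_mul, eval_pstar hN hz, eval_pstar hfN hz]
  have h1 := Complex.conj_eq_iff_im.2 (Complex.nonneg_iff.1 (h z hz)).2.symm
  rw [map_mul, Complex.conj_conj] at h1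
  linear_combination -z ^ N * h1

/-- If `f conj(p) ≥ 0` on the circle, then `f = R̃ Q`, where `Q` has degree at most `2 m̃` and
`z^(-m̃) Q ≥ 0` on the circle. -/
theorem exists_eq_RTilde_mul_of_nonneg {N : ℕ} {p f : ℂ[X]} (hp : p ≠ 0) (hN : p.natDegree ≤ N)
    (hfN : f.natDegree ≤ N)
    (h : ∀ z : ℂ, ‖z‖ = 1 → 0 ≤ f.eval z * starRingEnd ℂ (p.eval z)) :
    ∃ Q : ℂ[X], f = RTilde N p * Q ∧ Q.natDegree ≤ 2 * mTilde N p ∧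
      ∀ z : ℂ, ‖z‖ = 1 → 0 ≤ Q.eval z * starRingEnd ℂ (z ^ mTilde N p) := by
  rcases eq_or_ne f 0 with rfl | hf
  · exact ⟨0, by simp, by simp, by simp⟩
  have hs := mul_pstar_eq_of_nonneg hN hfN h
  obtain ⟨Q, hQ⟩ := RTilde_dvd hp hN hf hs fun a ha ho => isRoot_of_odd_of_nonneg hp h ha ho
  refine ⟨Q, hQ, natDegree_le_of_eq_mul_RTilde hp hN hf hfN hs hQ, fun z hz => ?_⟩
  refine nonneg_of_nonneg_off_zeros (F := fun z => Q.eval z * starRingEnd ℂ (z ^ mTilde N p)) hp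
    (Q.continuous.mul (Complex.continuous_conj.comp (by fun_prop))) (fun z hz hpz => ?_) hz
  obtain ⟨g, hg, hG⟩ := eval_GTilde N p hz
  have hfac := congrArg (eval z) (GTilde_mul_RTilde hp hN)
  rw [eval_mul] at hfac
  have hR0 : (RTilde N p).eval z ≠ 0 := by
    intro h0; rw [h0, mul_zero] at hfac; exact hpz hfac.symm
  have hg0 : 0 < g := by
    refine lt_of_le_of_ne hg fun h0 => hpz ?_
    rw [← hfac, hG, ← h0]; simp
  have hkey := h z hz
  rw [hQ, ← hfac, hG, eval_mul] at hkey
  have hc : 0 < g * ‖(RTilde N p).eval z‖ ^ 2 := by positivity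
  -- On the circle `f conj(p) = (Q conj(z^m̃)) · g |R̃|²`, and the last factor is positive off the
  -- zeros of `p`.
  have hkey2 : 0 ≤ (Q.eval z * starRingEnd ℂ (z ^ mTilde N p)) *
      ((g * ‖(RTilde N p).eval z‖ ^ 2 : ℝ) : ℂ) := by
    convert hkey using 1
    push_cast
    rw [← Complex.mul_conj']
    simp only [map_mul, Complex.conj_ofReal]
    ring
  exact nonneg_of_mul_ofReal_nonneg hc hkey2

theorem nonneg_of_eq_RTilde_mul {N : ℕ} {p Q : ℂ[X]} (hp : p ≠ 0) (hN : p.natDegree ≤ N) {z : ℂ}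
    (hz : ‖z‖ = 1) (hQ : 0 ≤ Q.eval z * starRingEnd ℂ (z ^ mTilde N p)) :
    0 ≤ (RTilde N p * Q).eval z * starRingEnd ℂ (p.eval z) := by
  obtain ⟨g, hg, hG⟩ := eval_GTilde N p hz
  have hfac := congrArg (eval z) (GTilde_mul_RTilde hp hN)
  rw [eval_mul, hG] at hfac
  have : (RTilde N p * Q).eval z * starRingEnd ℂ (p.eval z) =
      (Q.eval z * starRingEnd ℂ (z ^ mTilde N p)) *
        (g * ((RTilde N p).eval z * starRingEnd ℂ ((RTilde N p).eval z))) := by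
    rw [← hfac, eval_mul]
    simp only [map_mul, Complex.conj_ofReal]
    ring
  rw [this]
  exact mul_nonneg hQ (mul_nonneg (by exact_mod_cast hg) (self_mul_conj_nonneg _))

/-! ### The polynomial of a plus-vector -/

/-- The trigonometric polynomial `α₀ + ∑ (α_k cos kt - β_k sin kt)`. -/
noncomputable def trig {d : ℕ} (v : Fin (d + 1) ⊕ Fin d → ℝ) (t : ℝ) : ℝ :=
  v (Sum.inl 0) + ∑ i : Fin d,
    (v (Sum.inl i.succ) * cos (((i : ℝ) + 1) * t) - v (Sum.inr i) * sin (((i : ℝ) + 1) * t))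

/-- The polynomial `z^d (α₀ + ∑ ((α_k + i β_k) z^k + (α_k - i β_k) z^(-k)) / 2)`. -/
noncomputable def trigPoly {d : ℕ} (v : Fin (d + 1) ⊕ Fin d → ℝ) : ℂ[X] :=
  C (v (Sum.inl 0) : ℂ) * X ^ d + ∑ i : Fin d,
    (C (((v (Sum.inl i.succ) : ℂ) + v (Sum.inr i) * Complex.I) / 2) * X ^ (d + (i + 1)) +
      C (((v (Sum.inl i.succ) : ℂ) - v (Sum.inr i) * Complex.I) / 2) * X ^ (d - (i + 1)))

theorem trigPoly_smul {d : ℕ} (c : ℝ) (v : Fin (d + 1) ⊕ Fin d → ℝ) :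
    trigPoly (c • v) = C (c : ℂ) * trigPoly v := by
  have h : ∀ (w : ℂ) (n : ℕ), C ((c : ℂ) * w) * X ^ n = C (c : ℂ) * (C w * X ^ n) := fun w n => by
    rw [C_mul, mul_assoc]
  rw [trigPoly, trigPoly, mul_add, Finset.mul_sum]
  refine congrArg₂ (· + ·) ?_ (Finset.sum_congr rfl fun i _ => ?_)
  · rw [← h, Pi.smul_apply, smul_eq_mul, Complex.ofReal_mul]
  · rw [mul_add, ← h, ← h, ← mul_div_assoc, ← mul_div_assoc, mul_add, mul_sub]
    simp only [Pi.smul_apply, smul_eq_mul, Complex.ofReal_mul, mul_assoc]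

theorem eval_trigPoly {d : ℕ} (v : Fin (d + 1) ⊕ Fin d → ℝ) (t : ℝ) :
    (trigPoly v).eval (Complex.exp (t * Complex.I)) =
      Complex.exp (t * Complex.I) ^ d * (trig v t : ℂ) := by
  set z := Complex.exp (t * Complex.I) with hz
  have hz0 : z ≠ 0 := Complex.exp_ne_zero _
  simp only [trigPoly, trig, eval_add, eval_mul, eval_C, eval_pow, eval_X, eval_finsetSum,
    Complex.ofReal_add, Complex.ofReal_sum, mul_add, Finset.mul_sum]
  rw [mul_comm]
  congr 1
  refine Finset.sum_congr rfl fun i _ => ?_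
  have h1 : z ^ (d + (i + 1 : ℕ)) =
      z ^ d * Complex.exp (((((i : ℝ) + 1) * t : ℝ) : ℂ) * Complex.I) := by
    rw [pow_add, hz, ← Complex.exp_nat_mul _ ((i : ℕ) + 1)]
    congr 2
    push_cast
    ring
  have h2 : z ^ (d - (i + 1 : ℕ)) =
      z ^ d * Complex.exp (-((((i : ℝ) + 1) * t : ℝ) : ℂ) * Complex.I) := by
    rw [pow_sub₀ _ hz0 i.2, neg_mul, Complex.exp_neg]
    congr 2
    rw [hz, ← Complex.exp_nat_mul _ ((i : ℕ) + 1)]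
    congr 1
    push_cast
    ring
  rw [h1, h2, Complex.exp_mul_I, Complex.exp_mul_I, Complex.cos_neg, Complex.sin_neg]
  push_cast
  linear_combination z ^ d * (v (Sum.inr i) : ℂ) * Complex.sin (((i : ℂ) + 1) * t) * Complex.I_sq

theorem natDegree_trigPoly_le {d : ℕ} (v : Fin (d + 1) ⊕ Fin d → ℝ) :
    (trigPoly v).natDegree ≤ 2 * d := by
  refine natDegree_add_le_of_degree_le ((natDegree_C_mul_X_pow_le _ _).trans (by omega))
    (natDegree_sum_le_of_forall_le _ _ fun i _ => ?_)
  exact natDegree_add_le_of_degree_le ((natDegree_C_mul_X_pow_le _ _).trans (by omega))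
    ((natDegree_C_mul_X_pow_le _ _).trans (by omega))

theorem coeff_trigPoly_self {d : ℕ} (v : Fin (d + 1) ⊕ Fin d → ℝ) :
    (trigPoly v).coeff d = v (Sum.inl 0) := by
  rw [trigPoly, coeff_add, finsetSum_coeff, Finset.sum_eq_zero, add_zero]
  · simp
  · intro i _
    rw [coeff_add, coeff_C_mul_X_pow, coeff_C_mul_X_pow, if_neg (by omega), if_neg (by omega),
      add_zero]

theorem coeff_trigPoly_add {d : ℕ} (v : Fin (d + 1) ⊕ Fin d → ℝ) (i : Fin d) :
    (trigPoly v).coeff (d + (i + 1)) =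
      ((v (Sum.inl i.succ) : ℂ) + v (Sum.inr i) * Complex.I) / 2 := by
  rw [trigPoly, coeff_add, finsetSum_coeff, Finset.sum_eq_single i]
  · rw [coeff_add, coeff_C_mul_X_pow, coeff_C_mul_X_pow, coeff_C_mul_X_pow, if_neg (by omega),
      if_pos rfl, if_neg (by omega), add_zero, zero_add]
  · intro j _ hj
    have : (j : ℕ) ≠ i := fun h => hj (Fin.ext h)
    rw [coeff_add, coeff_C_mul_X_pow, coeff_C_mul_X_pow, if_neg (by omega), if_neg (by omega),
      add_zero]
  · simp

theorem coeff_trigPoly_sub {d : ℕ} (v : Fin (d + 1) ⊕ Fin d → ℝ) (i : Fin d) :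
    (trigPoly v).coeff (d - (i + 1)) =
      ((v (Sum.inl i.succ) : ℂ) - v (Sum.inr i) * Complex.I) / 2 := by
  have hi := i.2
  rw [trigPoly, coeff_add, finsetSum_coeff, Finset.sum_eq_single i]
  · rw [coeff_add, coeff_C_mul_X_pow, coeff_C_mul_X_pow, coeff_C_mul_X_pow, if_neg (by omega),
      if_neg (by omega), if_pos rfl, zero_add, zero_add]
  · intro j _ hj
    have : (j : ℕ) ≠ i := fun h => hj (Fin.ext h)
    rw [coeff_add, coeff_C_mul_X_pow, coeff_C_mul_X_pow, if_neg (by omega), if_neg (by omega),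
      add_zero]
  · simp

theorem trigPoly_injective {d : ℕ} :
    Function.Injective (trigPoly : (Fin (d + 1) ⊕ Fin d → ℝ) → ℂ[X]) := by
  intro v w h
  have h0 := congrArg (fun q => q.coeff d) h
  simp only [coeff_trigPoly_self] at h0
  have hi : ∀ i : Fin d, v (Sum.inl i.succ) = w (Sum.inl i.succ) ∧
      v (Sum.inr i) = w (Sum.inr i) := by
    intro i
    have h1 := congrArg (fun q => 2 * q.coeff (d + (i + 1))) h
    simp only [coeff_trigPoly_add, mul_div_cancel₀ _ (two_ne_zero' ℂ)] at h1
    exact ⟨by simpa using congrArg Complex.re h1, by simpa using congrArg Complex.im h1⟩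
  funext x
  rcases x with l | i
  · refine Fin.cases ?_ (fun i => (hi i).1) l
    exact_mod_cast h0
  · exact (hi i).2

theorem exists_trigPoly_eq {d : ℕ} {Q : ℂ[X]} (hQ : Q.natDegree ≤ 2 * d)
    (hs : pstar (2 * d) Q = Q) : ∃ v : Fin (d + 1) ⊕ Fin d → ℝ, Q = trigPoly v := by
  have hc : ∀ i ≤ 2 * d, Q.coeff i = starRingEnd ℂ (Q.coeff (2 * d - i)) := fun i hi => by
    conv_lhs => rw [← hs, coeff_pstar _ _ hi]
  -- The coefficients above the middle are `(α + iβ)/2`, hence the factors 2; the middle one is `α₀`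
  -- itself. Self-reciprocity determines the lower half.
  refine ⟨Sum.elim (Fin.cases (Q.coeff d).re fun i => 2 * (Q.coeff (d + (i + 1))).re)
    fun i => 2 * (Q.coeff (d + (i + 1))).im, ?_⟩
  ext n
  by_cases hn : 2 * d < n
  · rw [coeff_eq_zero_of_natDegree_lt (by omega),
      coeff_eq_zero_of_natDegree_lt ((natDegree_trigPoly_le _).trans_lt hn)]
  rcases lt_trichotomy n d with h | rfl | h
  · obtain ⟨i, rfl⟩ : ∃ i : Fin d, n = d - (i + 1) := ⟨⟨d - n - 1, by omega⟩, by simp; omega⟩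
    have hi := i.2
    rw [coeff_trigPoly_sub, hc _ (by omega), show 2 * d - (d - (i + 1)) = d + (i + 1) by omega]
    apply Complex.ext <;> simp [neg_div]
  · rw [coeff_trigPoly_self]
    have := hc n (by omega)
    rw [show 2 * n - n = n by omega] at this
    exact (Complex.conj_eq_iff_re.1 this.symm).symm
  · obtain ⟨i, rfl⟩ : ∃ i : Fin d, n = d + (i + 1) := ⟨⟨n - d - 1, by omega⟩, by simp; omega⟩
    rw [coeff_trigPoly_add]
    apply Complex.ext <;> simp

theorem exists_plusVector {d : ℕ} {Q : ℂ[X]} (hQ : Q.natDegree ≤ 2 * d)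
    (h : ∀ z : ℂ, ‖z‖ = 1 → 0 ≤ Q.eval z * starRingEnd ℂ (z ^ d)) :
    ∃ v : Fin (d + 1) ⊕ Fin d → ℝ, IsPlusVector v ∧ Q = trigPoly v := by
  -- Reality of `z^(-d) Q` on the circle is self-reciprocity of `Q` at level `2d`.
  have hs : pstar (2 * d) Q = Q := by
    refine eq_of_eval_eq_on_circle fun z hz => ?_
    have h1 := Complex.conj_eq_iff_im.2 (Complex.nonneg_iff.1 (h z hz)).2.symm
    have h2 : z ^ d * starRingEnd ℂ (z ^ d) = 1 := by
      rw [Complex.mul_conj', norm_pow, hz]; simp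
    rw [map_mul, Complex.conj_conj] at h1
    rw [eval_pstar hQ hz, two_mul, pow_add]
    linear_combination z ^ d * h1 + Q.eval z * h2
  obtain ⟨v, rfl⟩ := exists_trigPoly_eq hQ hs
  refine ⟨v, fun t _ => ?_, rfl⟩
  have hz : ‖Complex.exp (t * Complex.I)‖ = 1 := Complex.norm_exp_ofReal_mul_I t
  have h1 := h _ hz
  rw [eval_trigPoly, mul_right_comm, Complex.mul_conj', norm_pow, hz] at h1
  have h2 : 0 ≤ trig v t := by simpa using h1
  exact h2

theorem IsPlusVector.nonneg {d : ℕ} {v : Fin (d + 1) ⊕ Fin d → ℝ} (hv : IsPlusVector v) {z : ℂ}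
    (hz : ‖z‖ = 1) : 0 ≤ (trigPoly v).eval z * starRingEnd ℂ (z ^ d) := by
  obtain ⟨t, ht, -, rfl⟩ := exists_toCircle_eq hz
  rw [eval_trigPoly, mul_right_comm, Complex.mul_conj', norm_pow, hz]
  have : 0 ≤ trig v t := hv t ht
  simpa using this

/-! ### The kernel of the matrix -/

theorem coeff_C_mul_X_pow_mul_RTilde (N : ℕ) (p : ℂ[X]) (c : ℂ) (a n : ℕ) :
    (C c * X ^ a * RTilde N p).coeff n = c * CTilde N p ((n : ℤ) - a) := by
  rw [mul_assoc, coeff_C_mul, coeff_X_pow_mul', CTilde]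
  congr 1
  by_cases h : a ≤ n
  · rw [if_pos h, if_pos (by omega)]
    congr 1
    omega
  · rw [if_neg h, if_neg (by omega)]

theorem coeff_trigPoly_mul_RTilde (N : ℕ) (p : ℂ[X])
    (v : Fin (mTilde N p + 1) ⊕ Fin (mTilde N p) → ℝ) (n : ℕ) :
    (trigPoly v * RTilde N p).coeff n =
      v (Sum.inl 0) * CTilde N p (n - mTilde N p) + ∑ i : Fin (mTilde N p),
        (((v (Sum.inl i.succ) : ℂ) + v (Sum.inr i) * Complex.I) / 2 *
            CTilde N p (n - (i + 1) - mTilde N p) +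
          ((v (Sum.inl i.succ) : ℂ) - v (Sum.inr i) * Complex.I) / 2 *
            CTilde N p (n + (i + 1) - mTilde N p)) := by
  rw [trigPoly, add_mul, Finset.sum_mul, coeff_add, finsetSum_coeff,
    coeff_C_mul_X_pow_mul_RTilde]
  congr 1
  refine Finset.sum_congr rfl fun i _ => ?_
  have hi := i.2
  rw [add_mul, coeff_add, coeff_C_mul_X_pow_mul_RTilde, coeff_C_mul_X_pow_mul_RTilde]
  congr 3
  · push_cast; ring
  · rw [Nat.cast_sub (by omega)]
    push_cast; ring

/-- The factor 2 clears the halves in `trigPoly`; the column `l = 0` agrees because its two summands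
coincide. -/
theorem MTilde_mulVec_inl (N : ℕ) {M : ℕ} (k : Fin M → ℕ) (p : ℂ[X])
    (v : Fin (mTilde N p + 1) ⊕ Fin (mTilde N p) → ℝ) (j : Fin M) :
    (MTilde N k p).mulVec v (Sum.inl j) = 2 * ((trigPoly v * RTilde N p).coeff (k j)).re := by
  rw [coeff_trigPoly_mul_RTilde]
  simp only [MTilde, Matrix.mulVec, dotProduct, Fintype.sum_sum_type, Matrix.fromBlocks_apply₁₁,
    Matrix.fromBlocks_apply₁₂, plusMatrix, minusMatrix, Matrix.of_apply, Fin.sum_univ_succ,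
    ATilde, BTilde, Complex.add_re, Complex.re_sum, mul_add, Finset.mul_sum]
  rw [add_assoc, ← Finset.sum_add_distrib]
  congr 1
  · simp
    ring
  · refine Finset.sum_congr rfl fun i _ => ?_
    simp only [Complex.mul_re, Complex.div_ofNat_re, Complex.div_ofNat_im, Complex.add_re,
      Complex.add_im, Complex.sub_re, Complex.sub_im, Complex.ofReal_re, Complex.ofReal_im,
      Complex.mul_im, Complex.I_re, Complex.I_im, Fin.val_succ]
    push_cast
    ring

theorem MTilde_mulVec_inr (N : ℕ) {M : ℕ} (k : Fin M → ℕ) (p : ℂ[X])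
    (v : Fin (mTilde N p + 1) ⊕ Fin (mTilde N p) → ℝ) (j : Fin M) :
    (MTilde N k p).mulVec v (Sum.inr j) = 2 * ((trigPoly v * RTilde N p).coeff (k j)).im := by
  rw [coeff_trigPoly_mul_RTilde]
  simp only [MTilde, Matrix.mulVec, dotProduct, Fintype.sum_sum_type, Matrix.fromBlocks_apply₂₁,
    Matrix.fromBlocks_apply₂₂, plusMatrix, minusMatrix, Matrix.of_apply, Fin.sum_univ_succ,
    ATilde, BTilde, Complex.add_im, Complex.im_sum, mul_add, Finset.mul_sum, Matrix.neg_apply]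
  rw [add_assoc, ← Finset.sum_add_distrib]
  congr 1
  · simp
    ring
  · refine Finset.sum_congr rfl fun i _ => ?_
    simp only [Complex.mul_re, Complex.div_ofNat_re, Complex.div_ofNat_im, Complex.add_re,
      Complex.add_im, Complex.sub_re, Complex.sub_im, Complex.ofReal_re, Complex.ofReal_im,
      Complex.mul_im, Complex.I_re, Complex.I_im, Fin.val_succ]
    push_cast
    ring

theorem mem_NTilde_iff {N M : ℕ} {k : Fin M → ℕ} {p : ℂ[X]}
    {v : Fin (mTilde N p + 1) ⊕ Fin (mTilde N p) → ℝ} :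
    v ∈ NTilde N k p ↔ ∀ j, (trigPoly v * RTilde N p).coeff (k j) = 0 := by
  rw [NTilde, LinearMap.mem_ker, Matrix.mulVecLin_apply, funext_iff]
  constructor
  · intro h j
    have h1 := h (Sum.inl j)
    have h2 := h (Sum.inr j)
    rw [MTilde_mulVec_inl] at h1
    rw [MTilde_mulVec_inr] at h2
    apply Complex.ext
    · simpa using h1
    · simpa using h2
  · rintro h (j | j)
    · rw [MTilde_mulVec_inl, h j]; simp
    · rw [MTilde_mulVec_inr, h j]; simp

theorem mem_fewnomials_freq_iff {N M : ℕ} {k : Fin M → ℕ} {f : ℂ[X]} :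
    f ∈ fewnomials (freq N k) ↔ f.natDegree ≤ N ∧ ∀ j, f.coeff (k j) = 0 := by
  change f.support ⊆ freq N k ↔ _
  constructor
  · intro h
    refine ⟨natDegree_le_iff_coeff_eq_zero.2 fun n hn => ?_, fun j => ?_⟩
    · by_contra hne
      have := h (mem_support_iff.2 hne)
      simp [freq] at this
      omega
    · by_contra hne
      have := h (mem_support_iff.2 hne)
      simp [freq] at this
  · rintro ⟨hN, hk⟩ n hn
    rw [mem_support_iff] at hn
    simp only [freq, Finset.mem_sdiff, Finset.mem_range, Finset.mem_image, Finset.mem_univ,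
      true_and, not_exists]
    refine ⟨Nat.lt_succ_of_le ((le_natDegree_of_ne_zero hn).trans hN), ?_⟩
    rintro j rfl
    exact hn (hk j)

/-- The members `f` of `𝒫(Λ)` with `f conj(p) ≥ 0` on the circle correspond to the plus-vectors in
`Ñ`. -/
theorem mem_fewnomials_and_nonneg_iff {N M : ℕ} {k : Fin M → ℕ} {p f : ℂ[X]} (hp : p ≠ 0)
    (hN : p.natDegree ≤ N) :
    (f ∈ fewnomials (freq N k) ∧ ∀ z : ℂ, ‖z‖ = 1 → 0 ≤ f.eval z * starRingEnd ℂ (p.eval z)) ↔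
      ∃ v ∈ NTilde N k p, IsPlusVector v ∧ f = trigPoly v * RTilde N p := by
  constructor
  · rintro ⟨hf, h⟩
    rw [mem_fewnomials_freq_iff] at hf
    obtain ⟨Q, hQ, hdeg, hpos⟩ := exists_eq_RTilde_mul_of_nonneg hp hN hf.1 h
    obtain ⟨v, hv, rfl⟩ := exists_plusVector hdeg hpos
    rw [mul_comm] at hQ
    refine ⟨v, mem_NTilde_iff.2 ?_, hv, hQ⟩
    rw [← hQ]
    exact hf.2
  · rintro ⟨v, hv, hplus, rfl⟩
    refine ⟨mem_fewnomials_freq_iff.2 ⟨?_, mem_NTilde_iff.1 hv⟩, fun z hz => ?_⟩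
    · exact natDegree_mul_le.trans ((Nat.add_le_add_right (natDegree_trigPoly_le v) _).trans
        (two_mul_mTilde_add_natDegree_RTilde_le hp hN))
    · rw [mul_comm (trigPoly v)]
      exact nonneg_of_eq_RTilde_mul hp hN hz (hplus.nonneg hz)

/-! ### Exposed points -/

theorem coeFn_toL1 (f : ℂ[X]) :
    toL1 f =ᵐ[AddCircle.haarAddCircle] fun t : Arc => f.eval (AddCircle.toCircle t : ℂ) :=
  ContinuousMap.coeFn_toLp _ (onCircle f)

theorem continuous_eval_toCircle (f : ℂ[X]) :
    Continuous fun t : Arc => f.eval (AddCircle.toCircle t : ℂ) :=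
  (onCircle f).continuous

theorem integrable_of_continuous {E : Type*} [NormedAddCommGroup E] {F : Arc → E}
    (hF : Continuous F) : Integrable F AddCircle.haarAddCircle :=
  hF.integrable_of_hasCompactSupport (HasCompactSupport.of_compactSpace F)

theorem norm_toL1 (f : ℂ[X]) :
    ‖toL1 f‖ = ∫ t : Arc, ‖f.eval (AddCircle.toCircle t : ℂ)‖ ∂AddCircle.haarAddCircle := by
  rw [L1.norm_eq_integral_norm]
  exact integral_congr_ae ((coeFn_toL1 f).mono fun t ht => by simp only [ht])

theorem toL1_injective : Function.Injective toL1 := by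
  rw [injective_iff_map_eq_zero]
  intro f hf
  by_contra h0
  have h1 := coeFn_toL1 f
  rw [hf] at h1
  have h2 : ∀ᵐ t : Arc ∂AddCircle.haarAddCircle, False := by
    filter_upwards [h1, Lp.coeFn_zero ℂ 1 (AddCircle.haarAddCircle : Measure Arc),
      ae_eval_ne_zero h0] with t ht1 ht2 ht3
    exact ht3 (by rw [← ht1, ht2]; rfl)
  exact h2.exists.choose_spec

theorem exists_eq_mul_of_mul_conj_nonneg {w z : ℂ} (hz : z ≠ 0) (h : 0 ≤ w * starRingEnd ℂ z) :
    ∃ r : ℝ, 0 ≤ r ∧ w = r * z := by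
  obtain ⟨x, hx, hx'⟩ : ∃ x : ℝ, 0 ≤ x ∧ w * starRingEnd ℂ z = x :=
    ⟨_, (Complex.nonneg_iff.1 h).1, Complex.ext (by simp)
      (by simpa using (Complex.nonneg_iff.1 h).2.symm)⟩
  refine ⟨x / ‖z‖ ^ 2, by positivity, ?_⟩
  have hn : (‖z‖ : ℂ) ^ 2 ≠ 0 := by simpa using hz
  push_cast
  rw [← hx', div_mul_eq_mul_div, eq_div_iff hn, ← Complex.conj_mul']
  ring

/-- Here `w = r z` with `r ≥ 0`, so the norm is `|n + 1 - r| ‖z‖`; it differs from `(n + 1 - r) ‖z‖`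
only when `r > n + 1`, and the maximum covers that case. -/
theorem norm_mul_sub_le {w z : ℂ} (h : 0 ≤ w * starRingEnd ℂ z) (n : ℕ) :
    ‖((n : ℂ) + 1) * z - w‖ ≤ (n + 1) * ‖z‖ - ‖w‖ + 2 * max (‖w‖ - n * ‖z‖) 0 := by
  rcases eq_or_ne z 0 with rfl | hz
  · have := le_max_left (‖w‖ - n * ‖(0 : ℂ)‖) 0
    simp at this ⊢
    linarith
  obtain ⟨r, hr, rfl⟩ := exists_eq_mul_of_mul_conj_nonneg hz h
  have h1 : ‖((n : ℂ) + 1) * z - r * z‖ = |(n + 1 : ℝ) - r| * ‖z‖ := by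
    rw [← sub_mul, norm_mul, ← Real.norm_eq_abs, ← Complex.norm_real]
    push_cast
    rfl
  rw [h1, norm_mul, Complex.norm_real, Real.norm_eq_abs, abs_of_nonneg hr]
  have hz' := norm_nonneg z
  have h2 := le_max_left (r * ‖z‖ - n * ‖z‖) 0
  have h3 := le_max_right (r * ‖z‖ - n * ‖z‖) 0
  rcases abs_cases ((n + 1 : ℝ) - r) with ⟨h4, -⟩ | ⟨h4, -⟩ <;> rw [h4] <;> nlinarith

/-- The integrand is dominated by `|f|` and vanishes once `n ≥ |f| / |p|`, which happens eventually
wherever `p ≠ 0`. -/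
theorem tendsto_integral_max {p : ℂ[X]} (hp : p ≠ 0) (f : ℂ[X]) :
    Filter.Tendsto (fun n : ℕ => ∫ t : Arc, max (‖f.eval (AddCircle.toCircle t : ℂ)‖ -
      n * ‖p.eval (AddCircle.toCircle t : ℂ)‖) 0 ∂AddCircle.haarAddCircle) Filter.atTop
      (nhds 0) := by
  have hf := (continuous_eval_toCircle f).norm
  have hpc := (continuous_eval_toCircle p).norm
  have h := tendsto_integral_of_dominated_convergence (μ := (AddCircle.haarAddCircle : Measure Arc))
    (F := fun (n : ℕ) (t : Arc) => max (‖f.eval (AddCircle.toCircle t : ℂ)‖ -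
      n * ‖p.eval (AddCircle.toCircle t : ℂ)‖) 0) (f := fun _ => (0 : ℝ))
    (fun t => ‖f.eval (AddCircle.toCircle t : ℂ)‖)
    (fun n => ((hf.sub (continuous_const.mul hpc)).max continuous_const).aestronglyMeasurable)
    (integrable_of_continuous hf)
    (fun n => Filter.Eventually.of_forall fun t => by
      rw [Real.norm_eq_abs, abs_of_nonneg (le_max_right _ _)]
      refine max_le (sub_le_self _ (by positivity)) (norm_nonneg _))
    ((ae_eval_ne_zero hp).mono fun t ht => ?_)
  · simpa using h
  · have hpos := norm_pos_iff.2 ht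
    apply tendsto_const_nhds.congr'
    filter_upwards [Filter.eventually_ge_atTop
      ⌈‖f.eval (AddCircle.toCircle t : ℂ)‖ / ‖p.eval (AddCircle.toCircle t : ℂ)‖⌉₊] with n hn
    have := (div_le_iff₀ hpos).1 (Nat.ceil_le.1 hn)
    rw [max_eq_right (by linarith)]

/-- The functional `x ↦ ∫ x u` on `L¹`, where `u` is measurable and `|u| ≤ 1`. -/
noncomputable def integralMul (u : Arc → ℂ) (hu : Measurable u) (hb : ∀ t, ‖u t‖ ≤ 1) :
    L1 →L[ℂ] ℂ :=
  have hint : ∀ x : L1, Integrable (fun t => x t * u t) AddCircle.haarAddCircle := fun x =>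
    (L1.integrable_coeFn x).mul_bdd (c := 1) hu.aestronglyMeasurable (Filter.Eventually.of_forall hb)
  LinearMap.mkContinuous
    { toFun := fun x => ∫ t, x t * u t ∂AddCircle.haarAddCircle
      map_add' := fun x y => by
        rw [← integral_add (hint x) (hint y)]
        refine integral_congr_ae ((Lp.coeFn_add x y).mono fun t ht => ?_)
        simp only [ht, Pi.add_apply, add_mul]
      map_smul' := fun c x => by
        rw [RingHom.id_apply, smul_eq_mul, ← integral_const_mul]
        refine integral_congr_ae ((Lp.coeFn_smul c x).mono fun t ht => ?_)
        simp only [ht, Pi.smul_apply, smul_eq_mul, mul_assoc] } 1 fun x => by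
    rw [one_mul, L1.norm_eq_integral_norm]
    refine norm_integral_le_of_norm_le (L1.integrable_coeFn x).norm
      (Filter.Eventually.of_forall fun t => ?_)
    rw [norm_mul]
    exact mul_le_of_le_one_right (norm_nonneg _) (hb t)

theorem integralMul_toL1 (u : Arc → ℂ) (hu : Measurable u) (hb : ∀ t, ‖u t‖ ≤ 1) (f : ℂ[X]) :
    integralMul u hu hb (toL1 f) =
      ∫ t : Arc, f.eval (AddCircle.toCircle t : ℂ) * u t ∂AddCircle.haarAddCircle :=
  integral_congr_ae ((coeFn_toL1 f).mono fun t ht => by simp only [ht])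

theorem norm_integralMul_le (u : Arc → ℂ) (hu : Measurable u) (hb : ∀ t, ‖u t‖ ≤ 1) :
    ‖integralMul u hu hb‖ ≤ 1 :=
  by
  unfold integralMul
  exact LinearMap.mkContinuous_norm_le _ zero_le_one _

/-- A functional of norm `1` that attains its norm at `p` also attains it at every `f` with
`f / p ≥ 0`. -/
theorem apply_eq_one_of_nonneg {V : Submodule ℂ ℂ[X]} {p f : ℂ[X]} (hp : p ∈ V) (hf : f ∈ V)
    (hp₁ : ‖toL1 p‖ = 1) (hf₁ : ‖toL1 f‖ = 1)
    (h : ∀ z : ℂ, ‖z‖ = 1 → 0 ≤ f.eval z * starRingEnd ℂ (p.eval z))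
    {φ : (V.map toL1 : Submodule ℂ L1) →L[ℂ] ℂ} (hφ : ‖φ‖ = 1)
    (hφp : φ ⟨toL1 p, Submodule.mem_map_of_mem hp⟩ = 1) :
    φ ⟨toL1 f, Submodule.mem_map_of_mem hf⟩ = 1 := by
  have hp0 : p ≠ 0 := by rintro rfl; simp at hp₁
  set P : (V.map toL1 : Submodule ℂ L1) := ⟨toL1 p, Submodule.mem_map_of_mem hp⟩
  set F : (V.map toL1 : Submodule ℂ L1) := ⟨toL1 f, Submodule.mem_map_of_mem hf⟩
  have hle : ‖φ F‖ ≤ 1 := by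
    have := φ.le_opNorm F
    rwa [hφ, one_mul, show ‖F‖ = 1 from hf₁] at this
  -- Testing `φ` on `(n + 1) p - f` works because positivity makes its norm nearly `(n + 1) - 1`, up
  -- to an error that tends to 0. In the limit `Re φ(f) ≥ 1`.
  have hkey : ∀ n : ℕ, 1 - (φ F).re ≤ 2 * ∫ t : Arc, max (‖f.eval (AddCircle.toCircle t : ℂ)‖ -
      n * ‖p.eval (AddCircle.toCircle t : ℂ)‖) 0 ∂AddCircle.haarAddCircle := by
    intro n
    have h1 : (φ (((n : ℂ) + 1) • P - F)).re = n + 1 - (φ F).re := by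
      rw [map_sub, map_smul, hφp]; simp
    have h2 : (φ (((n : ℂ) + 1) • P - F)).re ≤ ‖((n : ℂ) + 1) • P - F‖ := by
      refine (Complex.re_le_norm _).trans ((φ.le_opNorm _).trans ?_)
      rw [hφ, one_mul]
    have h3 : ‖((n : ℂ) + 1) • P - F‖ = ‖toL1 (((n : ℂ) + 1) • p - f)‖ := by
      rw [map_sub, map_smul]; rfl
    have hfc := (continuous_eval_toCircle f).norm
    have hpc := (continuous_eval_toCircle p).norm
    have i1 := integrable_of_continuous (hpc.const_mul ((n : ℝ) + 1))
    have i2 := integrable_of_continuous hfc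
    have i3 : Integrable (fun t : Arc => 2 * max (‖f.eval (AddCircle.toCircle t : ℂ)‖ -
        n * ‖p.eval (AddCircle.toCircle t : ℂ)‖) 0) AddCircle.haarAddCircle :=
      integrable_of_continuous
        (((hfc.sub (hpc.const_mul (n : ℝ))).max continuous_const).const_mul 2)
    have h4 : ‖toL1 (((n : ℂ) + 1) • p - f)‖ ≤
        ∫ t : Arc, (((n : ℝ) + 1) * ‖p.eval (AddCircle.toCircle t : ℂ)‖ -
          ‖f.eval (AddCircle.toCircle t : ℂ)‖ +
          2 * max (‖f.eval (AddCircle.toCircle t : ℂ)‖ -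
            n * ‖p.eval (AddCircle.toCircle t : ℂ)‖) 0) ∂AddCircle.haarAddCircle := by
      rw [norm_toL1]
      refine integral_mono (integrable_of_continuous (continuous_eval_toCircle _).norm)
        ((i1.sub i2).add i3) fun t => ?_
      simpa using norm_mul_sub_le (h _ (Circle.norm_coe (AddCircle.toCircle t))) n
    have e1 := integral_add (i1.sub i2) i3
    simp only [Pi.sub_apply] at e1
    rw [e1, integral_sub i1 i2, integral_const_mul, integral_const_mul,
      ← norm_toL1, ← norm_toL1, hp₁, hf₁] at h4
    linarith
  have hlim := (tendsto_integral_max hp0 f).const_mul 2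
  have h1 : 1 - (φ F).re ≤ 0 := by
    simpa using ge_of_tendsto' hlim hkey
  have hre : (φ F).re = ‖φ F‖ := le_antisymm (Complex.re_le_norm _) (by linarith)
  have h2 : ‖φ F‖ = 1 := le_antisymm hle (by linarith)
  have h3 := Complex.nonneg_iff.1 (Complex.re_eq_norm.1 hre)
  exact Complex.ext (by rw [hre, h2]; rfl) h3.2.symm

/-- The functional `x ↦ ∫ x conj(p) / |p|` attains the value `1` on the ball only at `x` with
`x / p ≥ 0`. -/
theorem exists_functional (V : Submodule ℂ ℂ[X]) {p : ℂ[X]} (hp : p ∈ V) (hp₁ : ‖toL1 p‖ = 1) :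
    ∃ φ : (V.map toL1 : Submodule ℂ L1) →L[ℂ] ℂ, ‖φ‖ = 1 ∧
      φ ⟨toL1 p, Submodule.mem_map_of_mem hp⟩ = 1 ∧
      ∀ (f : ℂ[X]) (hf : f ∈ V), ‖toL1 f‖ ≤ 1 →
        φ ⟨toL1 f, Submodule.mem_map_of_mem hf⟩ = 1 → ‖toL1 f‖ = 1 ∧
          ∀ z : ℂ, ‖z‖ = 1 → 0 ≤ f.eval z * starRingEnd ℂ (p.eval z) := by
  have hp0 : p ≠ 0 := by rintro rfl; simp at hp₁
  -- At zeros of `p` the quotient is `0 / 0 = 0`, so the bound by 1 holds everywhere.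
  let u : Arc → ℂ := fun t => starRingEnd ℂ (p.eval (AddCircle.toCircle t : ℂ)) /
    (‖p.eval (AddCircle.toCircle t : ℂ)‖ : ℂ)
  have hpc := continuous_eval_toCircle p
  have hu : Measurable u :=
    (Complex.continuous_conj.comp hpc).measurable.div
      (Complex.continuous_ofReal.comp hpc.norm).measurable
  have hb : ∀ t, ‖u t‖ ≤ 1 := fun t => by
    simp only [u, norm_div, RCLike.norm_conj, Complex.norm_real, norm_norm]
    exact div_self_le_one _
  let φ := (integralMul u hu hb).comp (V.map toL1).subtypeL
  have hφle : ‖φ‖ ≤ 1 := by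
    refine ContinuousLinearMap.opNorm_le_bound _ zero_le_one fun x => ?_
    refine ((integralMul u hu hb).le_opNorm _).trans ?_
    exact mul_le_mul_of_nonneg_right (norm_integralMul_le u hu hb) (norm_nonneg _)
  have hφ : ∀ (f : ℂ[X]) (hf : f ∈ V), φ ⟨toL1 f, Submodule.mem_map_of_mem hf⟩ =
      ∫ t : Arc, f.eval (AddCircle.toCircle t : ℂ) * u t ∂AddCircle.haarAddCircle :=
    fun f _ => integralMul_toL1 u hu hb f
  have hφp : φ ⟨toL1 p, Submodule.mem_map_of_mem hp⟩ = 1 := by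
    rw [hφ p hp]
    have : ∀ t : Arc, p.eval (AddCircle.toCircle t : ℂ) * u t =
        ((‖p.eval (AddCircle.toCircle t : ℂ)‖ : ℝ) : ℂ) := fun t => by
      simp only [u]
      rw [← mul_div_assoc, Complex.mul_conj', pow_two, mul_self_div_self]
    simp_rw [this]
    rw [integral_complex_ofReal, ← norm_toL1, hp₁, Complex.ofReal_one]
  have hφ₁ : ‖φ‖ = 1 := by
    refine le_antisymm hφle ?_
    have := φ.le_opNorm ⟨toL1 p, Submodule.mem_map_of_mem hp⟩
    rwa [hφp, norm_one, Submodule.coe_norm, hp₁, mul_one] at this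
  refine ⟨φ, hφ₁, hφp, fun f hf hf₁ hφf => ?_⟩
  have hnorm : ‖toL1 f‖ = 1 := by
    refine le_antisymm hf₁ ?_
    have := φ.le_opNorm ⟨toL1 f, Submodule.mem_map_of_mem hf⟩
    rwa [hφf, norm_one, hφ₁, one_mul] at this
  refine ⟨hnorm, fun z hz => ?_⟩
  have hfc := continuous_eval_toCircle f
  have hi : Integrable (fun t : Arc => f.eval (AddCircle.toCircle t : ℂ) * u t)
      AddCircle.haarAddCircle :=
    (integrable_of_continuous hfc).mul_bdd (c := 1) hu.aestronglyMeasurable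
      (Filter.Eventually.of_forall hb)
  have hire : Integrable (fun t : Arc => (f.eval (AddCircle.toCircle t : ℂ) * u t).re)
      AddCircle.haarAddCircle := hi.re
  have hnn : ∀ t : Arc, 0 ≤ ‖f.eval (AddCircle.toCircle t : ℂ)‖ -
      (f.eval (AddCircle.toCircle t : ℂ) * u t).re := fun t => by
    have h1 := Complex.re_le_norm (f.eval (AddCircle.toCircle t : ℂ) * u t)
    rw [norm_mul] at h1
    have h2 := mul_le_of_le_one_right (norm_nonneg (f.eval (AddCircle.toCircle t : ℂ))) (hb t)
    linarith
  -- A nonnegative integrand with integral 0 vanishes almost everywhere, so `f u = |f|` almost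
  -- everywhere.
  have hint0 : ∫ t : Arc, (‖f.eval (AddCircle.toCircle t : ℂ)‖ -
      (f.eval (AddCircle.toCircle t : ℂ) * u t).re) ∂AddCircle.haarAddCircle = 0 := by
    have hre : ∫ t : Arc, (f.eval (AddCircle.toCircle t : ℂ) * u t).re
        ∂AddCircle.haarAddCircle = 1 := by
      have := integral_re hi
      rw [← hφ f hf, hφf] at this
      simpa using this
    rw [integral_sub (integrable_of_continuous hfc.norm) hire, ← norm_toL1, hnorm]
    simpa [sub_eq_zero] using hre.symm
  have hae := (integral_eq_zero_iff_of_nonneg hnn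
    ((integrable_of_continuous hfc.norm).sub hire)).1 hint0
  refine nonneg_on_circle_of_ae (F := fun z => f.eval z * starRingEnd ℂ (p.eval z))
    (f.continuous.mul (Complex.continuous_conj.comp p.continuous)) ?_ hz
  filter_upwards [hae, ae_eval_ne_zero hp0] with t ht hpt
  have h1 : (f.eval (AddCircle.toCircle t : ℂ) * u t).re =
      ‖f.eval (AddCircle.toCircle t : ℂ)‖ := by
    simp only [Pi.zero_apply] at ht
    linarith
  have h2 : 0 ≤ f.eval (AddCircle.toCircle t : ℂ) * u t := by
    refine Complex.re_eq_norm.1 (le_antisymm (Complex.re_le_norm _) ?_)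
    rw [h1, norm_mul]
    exact mul_le_of_le_one_right (norm_nonneg _) (hb t)
  have h3 : u t * (‖p.eval (AddCircle.toCircle t : ℂ)‖ : ℂ) =
      starRingEnd ℂ (p.eval (AddCircle.toCircle t : ℂ)) :=
    div_mul_cancel₀ _ (by simpa using hpt)
  rw [← h3, ← mul_assoc]
  exact mul_nonneg h2 (by exact_mod_cast norm_nonneg _)

theorem isExposedPointOfBall_iff {V : Submodule ℂ ℂ[X]} {p : ℂ[X]} (hp : p ∈ V)
    (hp₁ : ‖toL1 p‖ = 1) :
    IsExposedPointOfBall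
        (⟨toL1 p, Submodule.mem_map_of_mem hp⟩ : (V.map toL1 : Submodule ℂ L1)) ↔
      ∀ f ∈ V, ‖toL1 f‖ = 1 →
        (∀ z : ℂ, ‖z‖ = 1 → 0 ≤ f.eval z * starRingEnd ℂ (p.eval z)) → f = p := by
  constructor
  · rintro ⟨φ, hφ, hset⟩ f hf hf₁ h
    rw [Set.ext_iff] at hset
    have hφp := ((hset _).2 (Set.mem_singleton _)).2
    have hφf := apply_eq_one_of_nonneg hp hf hp₁ hf₁ h hφ hφp
    have hmem := (hset ⟨toL1 f, Submodule.mem_map_of_mem hf⟩).1 ⟨hf₁.le, hφf⟩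
    exact toL1_injective (congrArg Subtype.val (Set.mem_singleton_iff.1 hmem))
  · intro H
    obtain ⟨φ, hφ, hφp, hφu⟩ := exists_functional V hp hp₁
    refine ⟨φ, hφ, Set.Subset.antisymm ?_ ?_⟩
    · rintro ⟨_, f, hf, rfl⟩ ⟨h1, h2⟩
      obtain ⟨h3, h4⟩ := hφu f hf h1 h2
      rw [Set.mem_singleton_iff]
      exact Subtype.ext (congrArg toL1 (H f hf h3 h4))
    · rintro _ rfl
      exact ⟨hp₁.le, hφp⟩

/-! ### The plus-dimension -/

theorem plusDim_eq_one_iff {d : ℕ} {V : Submodule ℝ (Fin (d + 1) ⊕ Fin d → ℝ)}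
    {v₀ : Fin (d + 1) ⊕ Fin d → ℝ} (hv₀ : v₀ ∈ V) (hplus : IsPlusVector v₀) (hne : v₀ ≠ 0) :
    plusDim V = 1 ↔ ∀ v ∈ V, IsPlusVector v → ∃ c : ℝ, v = c • v₀ := by
  have hG := isGreatest_plusDim V
  constructor
  · intro h v hv hvp
    by_contra! hc
    have : 2 ∈ plusCounts V := by
      refine ⟨![v₀, v], (LinearIndependent.pair_iff' hne).2 fun a ha => hc a ha.symm, fun i => ?_⟩
      fin_cases i
      · exact ⟨hv₀, hplus⟩
      · exact ⟨hv, hvp⟩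
    have := hG.2 this
    omega
  · intro h
    refine le_antisymm ?_ (hG.2 ⟨fun _ => v₀, by simpa using hne, fun _ => ⟨hv₀, hplus⟩⟩)
    obtain ⟨w, hw, hwV⟩ := hG.1
    by_contra! hlt
    obtain ⟨a, ha⟩ := h _ (hwV ⟨0, by omega⟩).1 (hwV ⟨0, by omega⟩).2
    obtain ⟨b, hb⟩ := h _ (hwV ⟨1, hlt⟩).1 (hwV ⟨1, hlt⟩).2
    have hinj : Function.Injective ![(⟨0, by omega⟩ : Fin (plusDim V)), ⟨1, hlt⟩] := by
      intro i j hij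
      fin_cases i <;> fin_cases j <;> simp_all
    have hpair := hw.comp _ hinj
    -- The relation `b (a v₀) - a (b v₀) = 0` has coefficient `-a`, so independence gives `a = 0`
    -- and the first vector is zero.
    have hdep := Fintype.linearIndependent_iff.1 hpair ![b, -a]
      (by simp [Fin.sum_univ_two, ha, hb, smul_smul, mul_comm])
    have ha0 : a = 0 := by simpa using hdep 1
    exact hw.ne_zero ⟨0, by omega⟩ (by rw [ha, ha0, zero_smul])

/-! ### The criterion -/

theorem isExposedPointOfBall_iff_plusDim_eq_one {N M : ℕ} {k : Fin M → ℕ} {p : ℂ[X]}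
    (hp : p ∈ fewnomials (freq N k)) (hp₁ : ‖toL1 p‖ = 1) :
    IsExposedPointOfBall (⟨toL1 p, Submodule.mem_map_of_mem hp⟩ : fewnomialsL1 (freq N k)) ↔
      plusDim (NTilde N k p) = 1 := by
  have hp0 : p ≠ 0 := by rintro rfl; simp at hp₁
  have hdeg : p.natDegree ≤ N := (mem_fewnomials_freq_iff.1 hp).1
  -- The polynomial `p` is itself admissible, and its plus-vector spans the reference ray.
  obtain ⟨v₀, hv₀, hplus, hpv⟩ := (mem_fewnomials_and_nonneg_iff hp0 hdeg).1
    ⟨hp, fun z _ => self_mul_conj_nonneg _⟩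
  have hR := RTilde_ne_zero hp0 hdeg
  have hzero : trigPoly (0 : Fin (mTilde N p + 1) ⊕ Fin (mTilde N p) → ℝ) = 0 := by
    simpa using trigPoly_smul 0 (0 : Fin (mTilde N p + 1) ⊕ Fin (mTilde N p) → ℝ)
  have hne : v₀ ≠ 0 := by
    rintro rfl
    rw [hzero, zero_mul] at hpv
    exact hp0 hpv
  have hscale : ∀ (c : ℝ) (f : ℂ[X]), ‖toL1 (C (c : ℂ) * f)‖ = |c| * ‖toL1 f‖ := fun c f => by
    rw [← smul_eq_C_mul, map_smul, norm_smul, Complex.norm_real, Real.norm_eq_abs]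
  rw [isExposedPointOfBall_iff hp hp₁, plusDim_eq_one_iff hv₀ hplus hne]
  constructor
  · intro H v hv hvp
    obtain ⟨hfV, hfp⟩ := (mem_fewnomials_and_nonneg_iff hp0 hdeg).2 ⟨v, hv, hvp, rfl⟩
    set f := trigPoly v * RTilde N p with hf
    rcases eq_or_ne f 0 with h0 | h0
    · refine ⟨0, trigPoly_injective ?_⟩
      rw [zero_smul, hzero]
      exact (mul_eq_zero.1 h0).resolve_right hR
    · have hpos : 0 < ‖toL1 f‖ := norm_pos_iff.2 fun h => h0 (toL1_injective (by rw [h, map_zero]))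
      have hg := H (C ((‖toL1 f‖⁻¹ : ℝ) : ℂ) * f)
        (by rw [← smul_eq_C_mul]; exact Submodule.smul_mem _ _ hfV)
        (by rw [hscale, abs_of_pos (inv_pos.2 hpos), inv_mul_cancel₀ hpos.ne'])
        (fun z hz => by
          rw [eval_mul, eval_C, mul_assoc]
          exact mul_nonneg (by exact_mod_cast (inv_pos.2 hpos).le) (hfp z hz))
      -- Uniqueness at norm 1 says that `f / ‖f‖ = p`, so the scalar is the norm of `f`.
      refine ⟨‖toL1 f‖, trigPoly_injective (mul_right_cancel₀ hR ?_)⟩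
      rw [trigPoly_smul, mul_assoc, ← hpv, ← hf]
      conv_rhs => rw [← hg]
      rw [← mul_assoc, ← C_mul, ← Complex.ofReal_mul, mul_inv_cancel₀ hpos.ne',
        Complex.ofReal_one, C_1, one_mul]
  · intro H f hf hf₁ hfp
    obtain ⟨v, hv, hvp, hfv⟩ := (mem_fewnomials_and_nonneg_iff hp0 hdeg).1 ⟨hf, hfp⟩
    obtain ⟨c, rfl⟩ := H v hv hvp
    rw [trigPoly_smul, mul_assoc, ← hpv] at hfv
    obtain ⟨z, hz, hpz⟩ : ∃ z : ℂ, ‖z‖ = 1 ∧ p.eval z ≠ 0 := by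
      by_contra! h
      exact hp0 (eq_of_eval_eq_on_circle fun z hz => by rw [h z hz, eval_zero])
    -- Positivity at one point where `p ≠ 0` fixes the sign of `c`; the norm condition then gives `c
    -- = 1`.
    have hc : 0 ≤ c := by
      have h1 := hfp z hz
      rw [hfv, eval_mul, eval_C, mul_assoc, Complex.mul_conj', ← Complex.ofReal_pow] at h1
      have h2 := nonneg_of_mul_ofReal_nonneg (by positivity) h1
      exact_mod_cast h2
    rw [hfv, hscale, hp₁, mul_one, abs_of_nonneg hc] at hf₁
    rw [hfv, hf₁, Complex.ofReal_one, C_1, one_mul]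

end Fewnomial

theorem theorem3p1 (N M : ℕ) (hN : 0 < N) (k : Fin M → ℕ) (hk : StrictMono k)
    (hk₀ : ∀ j, 0 < k j) (hkN : ∀ j, k j < N)
    (p : Polynomial ℂ) (hp : p ∈ Fewnomial.fewnomials (Fewnomial.freq N k))
    (hp₁ : ‖Fewnomial.toL1 p‖ = 1) :
    Fewnomial.IsExposedPointOfBall
        (⟨Fewnomial.toL1 p, Submodule.mem_map_of_mem hp⟩ :
          Fewnomial.fewnomialsL1 (Fewnomial.freq N k)) ↔
      Fewnomial.plusDim (Fewnomial.NTilde N k p) = 1 :=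
  Fewnomial.isExposedPointOfBall_iff_plusDim_eq_one hp hp₁
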